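/- Let $\square=\mathbb R^d$ be the defining representation of $\mathrm{SO}(d)$, $\square^{\odot m}$ the totally symmetric tensors of rank $m$, $\square^{\vee m}$ the totally symmetric totally traceless ones, and $\square^{\wedge 2}$ the antisymmetric tensors of rank 2. Consider a Gauss law $Y_A^{i_1\dots i_k a}\,\partial_{i_1}\cdots\partial_{i_k}E^A=\rho^a$ on $\mathbb R^d$, where the smooth field $E$ takes values in a representation $R$ and the charge density $\rho$ in a representation $S$. For polynomials $f_a$, the moment $\int_U f_a\rho^a\,d^dx$ is *conserved* if there is a local flux $\Phi(E)$ (a vector depending smoothly on the position $x$ and on finitely many derivatives of $E$ at $x$) such that $\int_U f_a\rho^a\,d^dx=\oint_{\partial U}\Phi(E)\cdot dS$ for every such $E$ and every box $U=\prod_i[a_i,b_i]$. A moment is of order $l$ if the $f_a$ are homogeneous of degree $l$. The Gauss law is *non-fractonic* if the moments of order $0$ are conserved and no nonzero moment of order $l\ge1$ is; *fractonic* if the moments of order $0$ are conserved and the set of $l\ge 1$ for which some nonzero moment of order $l$ is conserved is finite and non-empty; *hyper-fractonic* if this set is infinite. For $l\ge k$ let $$Z\colon R\otimes\square^{\odot(l-k)}\to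 S\otimes\square^{\odot l}$$ send $E\otimes u$ to the total symmetrisation of $Y_A^{j_1\dots j_k a}E^A u^{j_{k+1}\dots j_l}$ in $j_1,\dots,j_l$; for $l<k$ put $Z=0$. Let $\operatorname{coker}(Z)=(S\otimes\square^{\odot l})/\operatorname{im}Z$. **(1) Totally traceless symmetric tensor theory.** Let $d\ge2$, $k\ge1$, and consider $\partial_{i_1}\cdots\partial_{i_k}E^{i_1\dots i_k}=\rho$ with $E\in R=\square^{\vee k}$ and $\rho$ scalar. For every $l\ge0$, as representations of $\mathrm{SO}(d)$, $$\operatorname{coker}(Z)\cong\bigoplus_{n=\max(0,\,l-k+1)}^{\lfloor l/2\rfloor}\square^{\vee(l-2n)},$$ which is nonzero if and only if $l\le 2k-2$. A moment $P_{j_1\dots j_l}\int_U x^{j_1}\cdots x^{j_l}\rho\,d^dx$ with $P\in\square^{\odot l}$ is conserved if and only if $P$ is orthogonal to $\operatorname{im}Z$. The conserved moments of order $l$ are exactly the linear combinations of $$\int_U|x|^{2n}x^{i_1}\cdots x^{i_{l-2n}}\rho\,d^dx,\qquad \max(0,\,l-k+1)\le n\le\lfloor l/2\rfloor,$$ and nonzero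 ones exist if and only if $l\le2k-2$. Hence only finitely many moments are conserved: the theory is never hyper-fractonic, it is fractonic for $k\ge2$, and it is non-fractonic for $k=1$. **(2) Symmetric traceless tensor with a vector charge.** Let $d\ge3$ and consider $\partial_iE^{ij}=\rho^j$ with $E\in R=\square^{\vee2}$ and $S=\square$. As representations of $\mathrm{SO}(d)$, $\operatorname{coker}(Z)$ is isomorphic to $\square$ for $l=0$, to $\mathbf 1\oplus\square^{\wedge2}$ for $l=1$, to $\square$ for $l=2$, and to $0$ for $l\ge3$. A moment $P_{j_1\dots j_l a}\int_U x^{j_1}\cdots x^{j_l}\rho^a\,d^dx$ with $P\in S\otimes\square^{\odot l}$ is conserved if and only if $P$ is orthogonal to $\operatorname{im}Z$. The conserved moments are, up to linear combinations within each order, exactly the four (tensor-valued) moments $$\int_U\rho^i,\qquad \int_U x\cdot\rho,\qquad \int_U(x^i\rho^j-x^j\rho^i),\qquad \int_U\bigl(|x|^2\rho^i-2(\rho\cdot x)x^i\bigr),$$ of orders $0,1,1,2$. Nonzero conserved moments of order $l$ exist if and only if $l\le2$, and the theory is fractonic but not hyper-fractonic. -/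

import Mathlib

open MeasureTheory
open scoped BigOperators ContDiff TensorProduct

noncomputable section

namespace Gauss

/-! ### Tensors on `ℝ^d` and the action of `SO(d)` -/

/-- The space `□^{⊗l}` of rank-`l` tensors on `ℝ^d`, in components. -/
abbrev Tensor (d l : ℕ) : Type := (Fin l → Fin d) → ℝ

/-- The rotation group `SO(d)`. -/
abbrev SO (d : ℕ) : Submonoid (Matrix (Fin d) (Fin d) ℝ) :=
  Matrix.specialOrthogonalGroup (Fin d) ℝ

/-- The space `□^{⊙l}` of totally symmetric tensors of rank `l`. -/
def symTensor (d l : ℕ) : Submodule ℝ (Tensor d l) where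
  carrier := {T | ∀ (σ : Equiv.Perm (Fin l)) (J : Fin l → Fin d), T (J ∘ σ) = T J}
  add_mem' := by
    intro S T hS hT σ J
    simp [hS σ J, hT σ J]
  zero_mem' := by
    intro σ J
    rfl
  smul_mem' := by
    intro c T hT σ J
    simp [hT σ J]

/-- The space `□^{∨l}` of totally symmetric tensors of rank `l` all of whose traces vanish. -/
def tracelessSym (d l : ℕ) : Submodule ℝ (Tensor d l) where
  carrier := {T | T ∈ symTensor d l ∧ ∀ s t : Fin l, s ≠ t → ∀ J : Fin l → Fin d,
    ∑ i : Fin d, T (Function.update (Function.update J s i) t i) = 0}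
  add_mem' := by
    intro S T hS hT
    refine ⟨add_mem hS.1 hT.1, fun s t hst J => ?_⟩
    simp [Finset.sum_add_distrib, hS.2 s t hst J, hT.2 s t hst J]
  zero_mem' := ⟨zero_mem _, fun s t _ J => by simp⟩
  smul_mem' := by
    intro c T hT
    refine ⟨Submodule.smul_mem _ c hT.1, fun s t hst J => ?_⟩
    simp [← Finset.mul_sum, hT.2 s t hst J]

/-- The space `□^{∧2}` of antisymmetric tensors of rank 2. -/
def antisymTensor (d : ℕ) : Submodule ℝ (Tensor d 2) where
  carrier := {T | ∀ J : Fin 2 → Fin d, T (J ∘ Equiv.swap 0 1) = - T J}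
  add_mem' := by
    intro S T hS hT J
    simp only [Pi.add_apply, hS J, hT J]
    ring
  zero_mem' := by
    intro J
    simp
  smul_mem' := by
    intro c T hT J
    simp only [Pi.smul_apply, hT J, smul_neg]

/-- The action of a matrix on tensors:
`(g T)^{j_1 … j_l} = g^{j_1}_{i_1} ⋯ g^{j_l}_{i_l} T^{i_1 … i_l}`. -/
def rotate {d l : ℕ} (g : Matrix (Fin d) (Fin d) ℝ) : Tensor d l →ₗ[ℝ] Tensor d l where
  toFun T := fun J => ∑ I : Fin l → Fin d, (∏ s, g (J s) (I s)) * T I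
  map_add' := by
    intro S T
    funext J
    simp [mul_add, Finset.sum_add_distrib]
  map_smul' := by
    intro c T
    funext J
    simp only [Pi.smul_apply, smul_eq_mul, RingHom.id_apply, Finset.mul_sum]
    exact Finset.sum_congr rfl fun I _ => by ring

theorem rotate_one {d l : ℕ} (T : Tensor d l) : rotate 1 T = T := by
  funext J
  show ∑ I : Fin l → Fin d, (∏ s, (1 : Matrix (Fin d) (Fin d) ℝ) (J s) (I s)) * T I = T J
  rw [Finset.sum_eq_single J]
  · simp
  · intro I _ hI
    obtain ⟨s, hs⟩ := Function.ne_iff.mp hI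
    have h0 : (1 : Matrix (Fin d) (Fin d) ℝ) (J s) (I s) = 0 := Matrix.one_apply_ne (Ne.symm hs)
    rw [Finset.prod_eq_zero (Finset.mem_univ s) h0, zero_mul]
  · simp

theorem rotate_mul {d l : ℕ} (g h : Matrix (Fin d) (Fin d) ℝ) (T : Tensor d l) :
    rotate (g * h) T = rotate g (rotate h T) := by
  funext J
  show ∑ I : Fin l → Fin d, (∏ s, (g * h) (J s) (I s)) * T I =
    ∑ K : Fin l → Fin d, (∏ s, g (J s) (K s)) *
      ∑ I : Fin l → Fin d, (∏ s, h (K s) (I s)) * T I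
  simp only [Matrix.mul_apply, Finset.mul_sum]
  rw [Finset.sum_comm]
  refine Finset.sum_congr rfl fun I _ => ?_
  rw [Finset.prod_univ_sum, Fintype.piFinset_univ, Finset.sum_mul]
  refine Finset.sum_congr rfl fun K _ => ?_
  rw [Finset.prod_mul_distrib]
  ring

theorem rotate_mem_symTensor {d l : ℕ} (g : Matrix (Fin d) (Fin d) ℝ) {T : Tensor d l}
    (hT : T ∈ symTensor d l) : rotate g T ∈ symTensor d l := by
  intro σ J
  show ∑ I : Fin l → Fin d, (∏ s, g (J (σ s)) (I s)) * T I =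
    ∑ I : Fin l → Fin d, (∏ s, g (J s) (I s)) * T I
  refine (Fintype.sum_equiv (Equiv.arrowCongr σ.symm (Equiv.refl (Fin d))) _ _ fun I => ?_).symm
  have h1 : (Equiv.arrowCongr σ.symm (Equiv.refl (Fin d))) I = I ∘ σ := by
    funext s
    simp [Equiv.arrowCongr]
  rw [h1, hT σ I]
  congr 1
  exact (Equiv.prod_comp σ fun s => g (J s) (I s)).symm

theorem rotate_mem_tracelessSym {d l : ℕ} (g : SO d) {T : Tensor d l}
    (hT : T ∈ tracelessSym d l) : rotate (g : Matrix (Fin d) (Fin d) ℝ) T ∈ tracelessSym d l := by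
  refine ⟨rotate_mem_symTensor _ hT.1, fun s t hst J => ?_⟩
  set A : Matrix (Fin d) (Fin d) ℝ := (g : Matrix (Fin d) (Fin d) ℝ) with hA
  have hg : A.transpose * A = 1 := by
    have := (Matrix.mem_specialOrthogonalGroup_iff.mp g.2).1
    exact (Matrix.mem_orthogonalGroup_iff' (Fin d) ℝ).mp this
  have hts : t ≠ s := Ne.symm hst
  -- the factor that does not involve the contracted indices
  set c : (Fin l → Fin d) → ℝ := fun I => ∏ u ∈ (Finset.univ.erase s).erase t, A (J u) (I u) with hc
  have hmt : t ∈ (Finset.univ : Finset (Fin l)).erase s := by simp [hts]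
  have hprod : ∀ (i : Fin d) (I : Fin l → Fin d),
      ∏ u, A (Function.update (Function.update J s i) t i u) (I u) =
        A i (I s) * A i (I t) * c I := by
    intro i I
    rw [← Finset.mul_prod_erase Finset.univ _ (Finset.mem_univ s),
      ← Finset.mul_prod_erase _ _ hmt, ← mul_assoc]
    congr 1
    · simp [Function.update_of_ne hst]
    · refine Finset.prod_congr rfl fun u hu => ?_
      have h1 : u ≠ t := Finset.ne_of_mem_erase hu
      have h2 : u ≠ s := Finset.ne_of_mem_erase (Finset.mem_of_mem_erase hu)
      rw [Function.update_of_ne h1, Function.update_of_ne h2]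
  have horth : ∀ a b : Fin d, ∑ i, A i a * A i b = if a = b then 1 else 0 := by
    intro a b
    have := congrFun (congrFun hg a) b
    rw [Matrix.mul_apply, Matrix.one_apply] at this
    simpa [Matrix.transpose_apply] using this
  show ∑ i, ∑ I : Fin l → Fin d,
    (∏ u, A (Function.update (Function.update J s i) t i u) (I u)) * T I = 0
  rw [Finset.sum_comm]
  have hstep : ∀ I : Fin l → Fin d,
      ∑ i, (∏ u, A (Function.update (Function.update J s i) t i u) (I u)) * T I =
        if I s = I t then c I * T I else 0 := by
    intro I
    simp only [hprod]
    have : ∀ i, A i (I s) * A i (I t) * c I * T I = A i (I s) * A i (I t) * (c I * T I) :=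
      fun i => by ring
    simp only [this, ← Finset.sum_mul, horth]
    split_ifs <;> simp
  rw [Finset.sum_congr rfl fun I _ => hstep I, ← Finset.sum_filter]
  rw [← Finset.sum_fiberwise_of_maps_to (t := Finset.univ)
    (g := fun I : Fin l → Fin d => Function.update (Function.update I s (J s)) t (J s))
    (fun _ _ => Finset.mem_univ _)]
  refine Finset.sum_eq_zero fun K _ => ?_
  by_cases hK : K s = J s ∧ K t = J s
  · have himg : ((Finset.univ.filter fun I : Fin l → Fin d => I s = I t).filter fun I =>
        Function.update (Function.update I s (J s)) t (J s) = K) =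
        Finset.univ.image fun i => Function.update (Function.update K s i) t i := by
      ext I
      simp only [Finset.mem_filter, Finset.mem_univ, true_and, Finset.mem_image]
      constructor
      · rintro ⟨h1, rfl⟩
        refine ⟨I s, ?_⟩
        funext u
        by_cases hut : u = t
        · subst hut; simp [h1]
        · by_cases hus : u = s
          · subst hus; simp [Function.update_of_ne hut]
          · simp [Function.update_of_ne hut, Function.update_of_ne hus]
      · rintro ⟨i, rfl⟩
        refine ⟨by simp [Function.update_of_ne hst], ?_⟩
        funext u
        by_cases hut : u = t
        · subst hut; simp [hK.2]
        · by_cases hus : u = s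
          · subst hus; simp [Function.update_of_ne hut, hK.1]
          · simp [Function.update_of_ne hut, Function.update_of_ne hus]
    rw [himg, Finset.sum_image]
    · have hcK : ∀ i, c (Function.update (Function.update K s i) t i) = c K := by
        intro i
        refine Finset.prod_congr rfl fun u hu => ?_
        have h1 : u ≠ t := Finset.ne_of_mem_erase hu
        have h2 : u ≠ s := Finset.ne_of_mem_erase (Finset.mem_of_mem_erase hu)
        rw [Function.update_of_ne h1, Function.update_of_ne h2]
      simp only [hcK, ← Finset.mul_sum, hT.2 s t hst K, mul_zero]
    · intro i _ j _ hij
      simpa using congrFun hij t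
  · refine Finset.sum_eq_zero fun I hI => absurd ?_ hK
    obtain ⟨_, rfl⟩ := Finset.mem_filter.mp hI
    simp [Function.update_of_ne hst]

/-- Total symmetrisation, normalised to be a projection. -/
def symmetrize {d l : ℕ} : Tensor d l →ₗ[ℝ] symTensor d l where
  toFun T := ⟨fun J => ((l.factorial : ℝ))⁻¹ * ∑ σ : Equiv.Perm (Fin l), T (J ∘ σ), by
    intro τ J
    have h := Equiv.sum_comp (Equiv.mulLeft τ) fun σ : Equiv.Perm (Fin l) => T (J ∘ σ)
    simp only [Equiv.coe_mulLeft, Equiv.Perm.coe_mul] at h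
    simp only [Function.comp_assoc, h]⟩
  map_add' := by
    intro S T
    ext J
    simp [Finset.sum_add_distrib, mul_add]
  map_smul' := by
    intro c T
    ext J
    simp only [Pi.smul_apply, smul_eq_mul, RingHom.id_apply, ← Finset.mul_sum,
      Submodule.coe_smul]
    ring

/-- The outer product `T^{j_1 … j_k} u^{j_{k+1} … j_l}`. -/
def outer {d k l : ℕ} (h : k ≤ l) : Tensor d k →ₗ[ℝ] Tensor d (l - k) →ₗ[ℝ] Tensor d l :=
  LinearMap.mk₂ ℝ
    (fun T u J => T (fun s => J (Fin.castLE h s)) *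
      u (fun s => J ⟨k + s, Nat.add_lt_of_lt_sub' s.isLt⟩))
    (by intros; funext J; simp [add_mul])
    (by intros; funext J; simp [mul_assoc])
    (by intros; funext J; simp [mul_add])
    (by intros; funext J; simp [mul_left_comm])

/-! ### Gauss laws -/

/-- A Gauss law `Y_A^{i_1 … i_k a} ∂_{i_1} ⋯ ∂_{i_k} E^A = ρ^a` of order `k` on `ℝ^d`. The electric
field takes values in an `SO(d)`-invariant space of rank-`p` tensors; the charge density has
components labelled by `ι`, on which `SO(d)` acts through matrices. The coefficients are
recorded as the equivariant linear map that sends a field value `E` to the tensors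
`Y_A^{i_1 … i_k a} E^A`, symmetric in the indices `i_1, …, i_k`. -/
structure GaussLaw (d p k : ℕ) (ι : Type) [Fintype ι] [DecidableEq ι] where
  electric : Submodule ℝ (Tensor d p)
  chargeRep : SO d →* Matrix ι ι ℝ
  coeff : Tensor d p →ₗ[ℝ] ι → Tensor d k
  electric_rotate : ∀ (g : SO d) (E : Tensor d p), E ∈ electric →
    rotate (g : Matrix (Fin d) (Fin d) ℝ) E ∈ electric
  coeff_symm : ∀ E ∈ electric, ∀ a, coeff E a ∈ symTensor d k
  coeff_rotate : ∀ (g : SO d), ∀ E ∈ electric, ∀ a,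
    coeff (rotate (g : Matrix (Fin d) (Fin d) ℝ) E) a =
      ∑ b, chargeRep g a b • rotate (g : Matrix (Fin d) (Fin d) ℝ) (coeff E b)

/-- The Gauss law `∂_{i_1} ⋯ ∂_{i_k} E^{i_1 … i_k} = ρ` for a totally symmetric, totally traceless
field of rank `k` and a scalar charge density. -/
def scalarLaw (d k : ℕ) : GaussLaw d k k Unit where
  electric := tracelessSym d k
  chargeRep := 1
  coeff := LinearMap.pi fun _ => LinearMap.id
  electric_rotate := fun g _ hE => rotate_mem_tracelessSym g hE
  coeff_symm := fun _ hE _ => hE.1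
  coeff_rotate := by
    intro g E _ a
    simp

/-- The Gauss law `∂_i E^{ij} = ρ^j` for a symmetric traceless field of rank 2 and a vector charge
density. -/
def vectorLaw (d : ℕ) : GaussLaw d 2 1 (Fin d) where
  electric := tracelessSym d 2
  chargeRep := (SO d).subtype
  coeff :=
    { toFun := fun E j I => E ![I 0, j]
      map_add' := by intros; rfl
      map_smul' := by intros; rfl }
  electric_rotate := fun g _ hE => rotate_mem_tracelessSym g hE
  coeff_symm := by
    intro E _ a σ J
    have : σ = 1 := Subsingleton.elim _ _
    subst this
    rfl
  coeff_rotate := by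
    intro g E _ a
    funext I
    simp only [LinearMap.coe_mk, AddHom.coe_mk, Finset.sum_apply, Pi.smul_apply, smul_eq_mul]
    show ∑ K : Fin 2 → Fin d, (∏ s, (g : Matrix (Fin d) (Fin d) ℝ) (![I 0, a] s) (K s)) * E K =
      ∑ b, (g : Matrix (Fin d) (Fin d) ℝ) a b *
        ∑ K : Fin 1 → Fin d, (∏ s, (g : Matrix (Fin d) (Fin d) ℝ) (I s) (K s)) * E ![K 0, b]
    rw [← (finTwoArrowEquiv (Fin d)).symm.sum_comp, Fintype.sum_prod_type, Finset.sum_comm]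
    refine Finset.sum_congr rfl fun b _ => ?_
    rw [← (Equiv.funUnique (Fin 1) (Fin d)).symm.sum_comp, Finset.mul_sum]
    refine Finset.sum_congr rfl fun i _ => ?_
    simp [Fin.prod_univ_two]
    ring

section Law

variable {d p k : ℕ} {ι : Type} [Fintype ι] [DecidableEq ι] (G : GaussLaw d p k ι)

/-- The charge density `ρ^a = Y_A^{i_1 … i_k a} ∂_{i_1} ⋯ ∂_{i_k} E^A` at the point `x`. -/
def chargeDensity (E : (Fin d → ℝ) → Tensor d p) (a : ι) (x : Fin d → ℝ) : ℝ :=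
  ∑ I : Fin k → Fin d,
    iteratedFDeriv ℝ k (fun y => G.coeff (E y) a I) x fun s => Pi.single (I s) 1

/-! ### Conserved moments -/

/-- The derivatives of order at most `N` of a rank-`p` tensor field at a point. -/
abbrev Jet (d p N : ℕ) : Type :=
  (m : Fin (N + 1)) → ContinuousMultilinearMap ℝ (fun _ : Fin m => Fin d → ℝ) (Tensor d p)

/-- The flux `∮_{∂U} F · n` of a vector field `F` through the boundary of the box
`U = ∏ i, [a i, b i]`: the sum over `i` of the integrals of `F i` over the face `x i = b i` minus
those over the face `x i = a i`. -/
def boundaryFlux {d : ℕ} (a b : Fin d → ℝ) (F : (Fin d → ℝ) → Fin d → ℝ) : ℝ :=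
  ∑ i : Fin d,
    ((∫ y in Set.Icc (fun j : {j : Fin d // j ≠ i} => a j) (fun j => b j),
        F (fun j => if h : j = i then b i else y ⟨j, h⟩) i) -
      ∫ y in Set.Icc (fun j : {j : Fin d // j ≠ i} => a j) (fun j => b j),
        F (fun j => if h : j = i then a i else y ⟨j, h⟩) i)

/-- The moment `∫_U f_a(x) ρ^a(x) dx` with polynomial weights `f_a` is conserved if, by the Gauss
law, it is the integral over the boundary `∂U` of a local flux: a vector that depends smoothly on
the position and on finitely many derivatives of `E` at that position. -/
def IsConserved (f : ι → MvPolynomial (Fin d) ℝ) : Prop :=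
  ∃ (N : ℕ) (Φ : (Fin d → ℝ) × Jet d p N → Fin d → ℝ), ContDiff ℝ ∞ Φ ∧
    ∀ E : (Fin d → ℝ) → Tensor d p, ContDiff ℝ ∞ E → (∀ x, E x ∈ G.electric) →
      ∀ a b : Fin d → ℝ, (∀ i, a i < b i) →
        ∫ x in Set.Icc a b, ∑ c, MvPolynomial.eval x (f c) * chargeDensity G E c x =
          boundaryFlux a b fun x => Φ (x, fun m => iteratedFDeriv ℝ m E x)

/-- There is a nonzero conserved moment of order `l`. -/
def HasConservedMoment (l : ℕ) : Prop :=
  ∃ f : ι → MvPolynomial (Fin d) ℝ, (∀ a, (f a).IsHomogeneous l) ∧ f ≠ 0 ∧ IsConserved G f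

/-- The charge `∫_U ρ^a` is conserved, for every `a`. -/
def ChargeConserved : Prop :=
  ∀ c : ι, IsConserved G (Pi.single c 1)

/-- Only the charge is conserved. -/
def IsNonFractonic : Prop :=
  ChargeConserved G ∧ ∀ l, 1 ≤ l → ¬ HasConservedMoment G l

/-- Besides the charge, a finite (nonzero) number of higher moments is conserved. -/
def IsFractonic : Prop :=
  ChargeConserved G ∧ {l | 1 ≤ l ∧ HasConservedMoment G l}.Finite ∧
    {l | 1 ≤ l ∧ HasConservedMoment G l}.Nonempty

/-- An infinite tower of higher moments is conserved. -/
def IsHyperFractonic : Prop :=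
  {l | 1 ≤ l ∧ HasConservedMoment G l}.Infinite

/-! ### The map `Z` and its cokernel -/

variable (d ι) in
/-- The space `S ⊗ □^{⊙l}`, in components: symmetric rank-`l` tensors with a charge index. -/
def momentSpace (l : ℕ) : Submodule ℝ (ι → Tensor d l) :=
  Submodule.pi Set.univ fun _ => symTensor d l

/-- The action of `SO(d)` on `S ⊗ □^{⊙l}`. -/
def momentRotate (l : ℕ) (g : SO d) (M : momentSpace d ι l) : momentSpace d ι l :=
  ⟨fun a => ∑ b, G.chargeRep g a b • rotate (g : Matrix (Fin d) (Fin d) ℝ) (M.1 b),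
    fun _ _ => Submodule.sum_mem _ fun b _ =>
      Submodule.smul_mem _ _ (rotate_mem_symTensor _ (M.2 b (Set.mem_univ b)))⟩

/-- The map `Z : R ⊗ □^{⊙(l-k)} → S ⊗ □^{⊙l}`, for `k ≤ l`, sending `E ⊗ u` to the total
symmetrisation of `Y_A^{j_1 … j_k a} E^A u^{j_{k+1} … j_l}` in `j_1, …, j_l`. -/
def Z {l : ℕ} (h : k ≤ l) : G.electric ⊗[ℝ] symTensor d (l - k) →ₗ[ℝ] momentSpace d ι l :=
  TensorProduct.lift <| LinearMap.mk₂ ℝ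
    (fun E u => (⟨fun c => (symmetrize (outer h (G.coeff E.1 c) u.1)).1,
      fun _ _ => (symmetrize _).2⟩ : momentSpace d ι l))
    (by intros; ext a J; simp)
    (by intros; ext a J; simp)
    (by intros; ext a J; simp)
    (by intros; ext a J; simp)

/-- The image of `Z` in `S ⊗ □^{⊙l}`; it is zero for `l < k`, where `R ⊗ □^{⊙(l-k)}` is zero. -/
def imZ (l : ℕ) : Submodule ℝ (momentSpace d ι l) :=
  ⨆ h : k ≤ l, LinearMap.range (Z G h)

/-- The cokernel of `Z`. -/
abbrev cokerZ (l : ℕ) : Type := momentSpace d ι l ⧸ imZ G l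

/-- The inner product on `S ⊗ □^{⊙l}`. -/
def momentInner {l : ℕ} (M M' : momentSpace d ι l) : ℝ :=
  ∑ a, ∑ J : Fin l → Fin d, M.1 a J * M'.1 a J

/-- The polynomials `f_a(x) = P_{j_1 … j_l a} x^{j_1} ⋯ x^{j_l}` with coefficients in `S ⊗ □^{⊙l}`. -/
def weight {l : ℕ} (P : momentSpace d ι l) : ι → MvPolynomial (Fin d) ℝ :=
  fun a => ∑ J : Fin l → Fin d, MvPolynomial.C (P.1 a J) * ∏ s, MvPolynomial.X (J s)

end Law

/-- The polynomial `|x|²`. -/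
def normSq (d : ℕ) : MvPolynomial (Fin d) ℝ := ∑ i, MvPolynomial.X i ^ 2

end Gauss

end

noncomputable section

namespace Gauss

open MvPolynomial

/-! ### Polynomials and symmetric tensors -/

/-! The analytic half reduces conservation to a differential equation. Integrating by parts `k`
times turns `∫ f_a ρ^a` into a boundary flux plus `(-1)^k ∫ Y_A^{i_1…i_k a} E^A ∂_{i_1}⋯∂_{i_k}
f_a`. The moment is therefore conserved as soon as this adjoint operator, `gaussOp`, kills `f` for
every constant `E ∈ R`. Conversely, insert fields `χ E₀` with `χ` a smooth cutoff supported inside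
the box. On the boundary they have the jets of the zero field, so the flux cannot see `χ`. Hence `∫
χ q = 0` for every `χ`, where `q = gaussOp G E₀ f`, and `q = 0`. This is `isConserved_iff`.

The algebraic half identifies `coker Z` with the solutions. Symmetric tensors of rank `l` are
homogeneous polynomials of degree `l`, and their inner product is, up to `l!`, the Fischer pairing
`⟨p, q⟩ = (p(∂) q)(0)`, for which multiplication by `x_i` is adjoint to `∂_i`. In these terms `Z`
multiplies the polynomials of `Y_A E^A` by that of `u`, so `gaussOp` is its adjoint
(`sum_fischer_weight_Z`). The pairing is positive definite, so `coker Z ≅ (im Z)^⊥` is the space of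
solutions; `exists_cokerZ_equiv` transports this identification `SO(d)`-equivariantly to any
equivariant parametrisation of the solutions.

It remains to solve two equations. For the scalar charge, `E` runs over the harmonic polynomials `h`
of degree `k`. In degree `l = k` the condition `h(∂) f = 0` says that `f` is Fischer-orthogonal to
the harmonics, that is, divisible by `|x|²`. Differentiation commutes with `h(∂)`, and each further
degree gains one factor of `|x|²`, so the solutions of degree `l` are the multiples of
`|x|^{2(l+1-k)}` (`scalarLaw_adjoint_iff`). Decomposing the quotient into harmonics gives the sum of
the `□^{∨(l-2n)}`, and comparing degrees gives `l ≤ 2k - 2`.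

For the vector charge, orthogonality to all symmetric traceless matrices is the conformal Killing
equation `∂_i f_j + ∂_j f_i = 2 δ_{ij} σ`. For `d ≥ 3` it forces `∂∂σ = 0`, so homogeneous solutions
have degree at most 2: translations, a dilation and rotations, special conformal fields. -/

theorem sum_fin_cons {d l : ℕ} {A : Type*} [AddCommMonoid A] (F : (Fin (l + 1) → Fin d) → A) :
    ∑ J, F J = ∑ i, ∑ J : Fin l → Fin d, F (Fin.cons i J) := by
  rw [← (Fin.consEquiv fun _ => Fin d).sum_comp, Fintype.sum_prod_type]
  rfl

theorem pderiv_comm {d : ℕ} (i j : Fin d) (f : MvPolynomial (Fin d) ℝ) :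
    pderiv i (pderiv j f) = pderiv j (pderiv i f) := by
  ext m
  by_cases h : i = j
  · rw [h]
  · simp only [coeff_pderiv, Finsupp.add_apply, Finsupp.single_apply, h, Ne.symm h, if_false,
      add_zero]
    rw [add_right_comm]
    ring

/-- The iterated partial derivative `∂_{i_1} ⋯ ∂_{i_k}` of a polynomial. -/
def iterPderiv {d : ℕ} : (k : ℕ) → (Fin k → Fin d) →
    MvPolynomial (Fin d) ℝ →ₗ[ℝ] MvPolynomial (Fin d) ℝ
  | 0, _ => LinearMap.id
  | k + 1, I => iterPderiv k (Fin.tail I) ∘ₗ (pderiv (I 0)).toLinearMap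

theorem iterPderiv_zero {d : ℕ} (I : Fin 0 → Fin d) (f : MvPolynomial (Fin d) ℝ) :
    iterPderiv 0 I f = f := rfl

theorem iterPderiv_succ {d k : ℕ} (I : Fin (k + 1) → Fin d) (f : MvPolynomial (Fin d) ℝ) :
    iterPderiv (k + 1) I f = iterPderiv k (Fin.tail I) (pderiv (I 0) f) := rfl

theorem iterPderiv_pderiv {d k : ℕ} (i : Fin d) (I : Fin k → Fin d) (f : MvPolynomial (Fin d) ℝ) :
    iterPderiv k I (pderiv i f) = pderiv i (iterPderiv k I f) := by
  induction k generalizing f with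
  | zero => rfl
  | succ k ih => rw [iterPderiv_succ, iterPderiv_succ, pderiv_comm, ih]

theorem isHomogeneous_iterPderiv {d k l : ℕ} (I : Fin k → Fin d) {f : MvPolynomial (Fin d) ℝ}
    (hf : f.IsHomogeneous l) : (iterPderiv k I f).IsHomogeneous (l - k) := by
  induction k generalizing f l with
  | zero => exact hf
  | succ k ih =>
    rw [iterPderiv_succ]
    have := ih (Fin.tail I) (hf.pderiv (i := I 0))
    rwa [Nat.sub_sub, add_comm 1 k] at this

theorem pderiv_eq_zero_of_isHomogeneous_zero {d : ℕ} (i : Fin d) {f : MvPolynomial (Fin d) ℝ}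
    (hf : f.IsHomogeneous 0) : pderiv i f = 0 := by
  rw [← totalDegree_zero_iff_isHomogeneous, totalDegree_eq_zero_iff_eq_C] at hf
  rw [hf, pderiv_C]

theorem iterPderiv_eq_zero {d k l : ℕ} (h : l < k) (I : Fin k → Fin d)
    {f : MvPolynomial (Fin d) ℝ} (hf : f.IsHomogeneous l) : iterPderiv k I f = 0 := by
  induction k generalizing f l with
  | zero => omega
  | succ k ih =>
    rw [iterPderiv_succ]
    rcases Nat.eq_zero_or_pos l with rfl | hl
    · rw [pderiv_eq_zero_of_isHomogeneous_zero _ hf, map_zero]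
    · exact ih (by omega) _ hf.pderiv

/-- Euler's identity `∑ x_i ∂_i f = l f`. It makes induction on the degree by differentiation
possible throughout. -/
theorem eq_zero_of_forall_pderiv_eq_zero {d l : ℕ} (hl : l ≠ 0) {f : MvPolynomial (Fin d) ℝ}
    (hf : f.IsHomogeneous l) (h : ∀ i, pderiv i f = 0) : f = 0 := by
  have := hf.sum_X_mul_pderiv
  simp only [h, mul_zero, Finset.sum_const_zero] at this
  exact (smul_eq_zero.mp this.symm).resolve_left hl

/-- The polynomial `T_{j_1 … j_l} x^{j_1} ⋯ x^{j_l}`. -/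
def tensorPoly {d l : ℕ} : Tensor d l →ₗ[ℝ] MvPolynomial (Fin d) ℝ where
  toFun T := ∑ J : Fin l → Fin d, C (T J) * ∏ s, X (J s)
  map_add' S T := by simp [add_mul, Finset.sum_add_distrib]
  map_smul' c T := by simp [smul_eq_C_mul, Finset.mul_sum, mul_assoc]

theorem tensorPoly_apply {d l : ℕ} (T : Tensor d l) :
    tensorPoly T = ∑ J : Fin l → Fin d, C (T J) * ∏ s, X (J s) := rfl

theorem isHomogeneous_prod_X {d l : ℕ} (J : Fin l → Fin d) :
    (∏ s, X (J s) : MvPolynomial (Fin d) ℝ).IsHomogeneous l := by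
  simpa using IsHomogeneous.prod Finset.univ (fun s => (X (J s) : MvPolynomial (Fin d) ℝ))
    (fun _ => 1) fun s _ => isHomogeneous_X ℝ (J s)

theorem isHomogeneous_tensorPoly {d l : ℕ} (T : Tensor d l) :
    (tensorPoly T).IsHomogeneous l :=
  IsHomogeneous.sum _ _ _ fun J _ => (isHomogeneous_prod_X J).C_mul _

theorem tensorPoly_zero_rank {d : ℕ} (T : Tensor d 0) : tensorPoly T = C (T Fin.elim0) := by
  rw [tensorPoly_apply, Fintype.sum_unique]
  simp [Subsingleton.elim (default : Fin 0 → Fin d) Fin.elim0]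

theorem tensorPoly_succ {d l : ℕ} (T : Tensor d (l + 1)) :
    tensorPoly T = ∑ i, X i * tensorPoly fun J => T (Fin.cons i J) := by
  rw [tensorPoly_apply, sum_fin_cons]
  refine Finset.sum_congr rfl fun i _ => ?_
  rw [tensorPoly_apply, Finset.mul_sum]
  refine Finset.sum_congr rfl fun J _ => ?_
  rw [Fin.prod_univ_succ]
  simp only [Fin.cons_zero, Fin.cons_succ]
  ring

theorem symTensor_cons {d l : ℕ} {T : Tensor d (l + 1)} (hT : T ∈ symTensor d (l + 1))
    (i : Fin d) : (fun J => T (Fin.cons i J)) ∈ symTensor d l := by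
  intro σ J
  -- A permutation of the tail is extended to all slots by fixing slot 0.
  have h := hT (Equiv.Perm.decomposeFin.symm (0, σ)) (Fin.cons i J)
  refine Eq.trans (congrArg T ?_) h
  funext s
  refine Fin.cases ?_ (fun s => ?_) s <;> simp

theorem symTensor_cons_cons {d l : ℕ} {T : Tensor d (l + 2)} (hT : T ∈ symTensor d (l + 2))
    (i j : Fin d) (J : Fin l → Fin d) :
    T (Fin.cons i (Fin.cons j J)) = T (Fin.cons j (Fin.cons i J)) := by
  rw [← hT (Equiv.swap 0 1) (Fin.cons i (Fin.cons j J))]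
  congr 1
  funext s
  refine Fin.cases ?_ (fun s => ?_) s
  · rw [Function.comp_apply, Equiv.swap_apply_left]
    rfl
  · refine Fin.cases ?_ (fun s => ?_) s
    · rw [Function.comp_apply, show (Fin.succ 0 : Fin (l + 2)) = 1 from rfl,
        Equiv.swap_apply_right]
      rfl
    · have h0 : (s.succ.succ : Fin (l + 2)) ≠ 0 := Fin.succ_ne_zero _
      have h1 : (s.succ.succ : Fin (l + 2)) ≠ 1 := fun h =>
        Fin.succ_ne_zero s (Fin.succ_injective _ h)
      simp [Equiv.swap_apply_of_ne_of_ne h0 h1]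

/-- By symmetry of `T`, each of the `l + 1` factors that the product rule differentiates contributes
the same term. -/
theorem pderiv_tensorPoly {d l : ℕ} {T : Tensor d (l + 1)} (hT : T ∈ symTensor d (l + 1))
    (i : Fin d) :
    pderiv i (tensorPoly T) = (l + 1 : ℝ) • tensorPoly fun J => T (Fin.cons i J) := by
  induction l generalizing i with
  | zero =>
    rw [tensorPoly_succ]
    simp [tensorPoly_zero_rank, Pi.single_apply, pderiv_X, map_sum]
  | succ l ih =>
    rw [tensorPoly_succ T]
    simp only [map_sum, pderiv_mul, pderiv_X, Finset.sum_add_distrib]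
    have h1 : ∀ j, pderiv i (tensorPoly fun J => T (Fin.cons j J)) =
        (l + 1 : ℝ) • tensorPoly fun J => T (Fin.cons i (Fin.cons j J)) := by
      intro j
      rw [ih (symTensor_cons hT j)]
      congr 2
      funext J
      exact symTensor_cons_cons hT _ _ J
    simp only [h1, Pi.single_apply, ite_mul, one_mul, zero_mul, mul_smul_comm]
    rw [← Finset.smul_sum, ← tensorPoly_succ (fun J => T (Fin.cons i J)), Finset.sum_ite_eq']
    simp only [Finset.mem_univ, if_true]
    push_cast
    module

/-- Full differentiation recovers the components of a symmetric tensor from its polynomial; this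
gives injectivity and the constant `l!` in the Fischer pairing. -/
theorem iterPderiv_tensorPoly {d l : ℕ} {T : Tensor d l} (hT : T ∈ symTensor d l)
    (I : Fin l → Fin d) : iterPderiv l I (tensorPoly T) = C (l.factorial * T I) := by
  induction l with
  | zero =>
    rw [iterPderiv_zero, tensorPoly_zero_rank]
    simp [Subsingleton.elim I Fin.elim0]
  | succ l ih =>
    rw [iterPderiv_succ, pderiv_tensorPoly hT, map_smul, ih (symTensor_cons hT _),
      smul_eq_C_mul, ← C_mul, Fin.cons_self_tail, Nat.factorial_succ]
    push_cast
    ring_nf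

theorem tensorPoly_injOn {d l : ℕ} {S T : Tensor d l} (hS : S ∈ symTensor d l)
    (hT : T ∈ symTensor d l) (h : tensorPoly S = tensorPoly T) : S = T := by
  funext I
  have := congrArg (iterPderiv l I) h
  rw [iterPderiv_tensorPoly hS, iterPderiv_tensorPoly hT] at this
  exact mul_left_cancel₀ (by positivity) (C_injective _ _ this)

theorem tensorPoly_symmetrize {d l : ℕ} (T : Tensor d l) :
    tensorPoly (symmetrize T).1 = tensorPoly T := by
  have h : (symmetrize T).1 = (l.factorial : ℝ)⁻¹ • ∑ σ : Equiv.Perm (Fin l),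
      (fun J => T (J ∘ σ) : Tensor d l) := by
    funext J
    simp [symmetrize]
  have hσ : ∀ σ : Equiv.Perm (Fin l), tensorPoly (fun J => T (J ∘ σ) : Tensor d l) =
      tensorPoly T := by
    intro σ
    rw [tensorPoly_apply, tensorPoly_apply]
    refine Fintype.sum_equiv (Equiv.arrowCongr σ.symm (Equiv.refl (Fin d))) _ _ fun J => ?_
    have h1 : (Equiv.arrowCongr σ.symm (Equiv.refl (Fin d))) J = J ∘ σ := by
      funext s
      simp [Equiv.arrowCongr]
    rw [h1]
    congr 1
    exact (Equiv.prod_comp σ fun s => (X (J s) : MvPolynomial (Fin d) ℝ)).symm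
  rw [h, map_smul, map_sum, Finset.sum_congr rfl fun σ _ => hσ σ, Finset.sum_const,
    Finset.card_univ, Fintype.card_perm, Fintype.card_fin, ← Nat.cast_smul_eq_nsmul ℝ, smul_smul,
    inv_mul_cancel₀ (by positivity), one_smul]

/-- Euler's identity again: tensors for the partial derivatives are stacked along a new first slot
and divided by the degree. -/
theorem exists_tensorPoly_eq {d l : ℕ} {f : MvPolynomial (Fin d) ℝ} (hf : f.IsHomogeneous l) :
    ∃ T : Tensor d l, tensorPoly T = f := by
  induction l generalizing f with
  | zero =>
    rw [← totalDegree_zero_iff_isHomogeneous, totalDegree_eq_zero_iff_eq_C] at hf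
    exact ⟨fun _ => coeff 0 f, by rw [tensorPoly_zero_rank, ← hf]⟩
  | succ l ih =>
    choose T hT using fun i => ih (hf.pderiv (i := i))
    refine ⟨(l + 1 : ℝ)⁻¹ • fun J => T (J 0) (Fin.tail J), ?_⟩
    rw [map_smul, tensorPoly_succ]
    simp only [Fin.cons_zero, Fin.tail_cons, hT]
    rw [hf.sum_X_mul_pderiv, ← Nat.cast_smul_eq_nsmul ℝ, smul_smul]
    push_cast
    rw [inv_mul_cancel₀ (by positivity), one_smul]

/-- Symmetric tensors of rank `l` are the same as homogeneous polynomials of degree `l`. -/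
def symPolyEquiv (d l : ℕ) : symTensor d l ≃ₗ[ℝ] homogeneousSubmodule (Fin d) ℝ l :=
  LinearEquiv.ofBijective
    ((tensorPoly.comp (symTensor d l).subtype).codRestrict _ fun T => isHomogeneous_tensorPoly T.1)
    ⟨fun S T h => Subtype.ext (tensorPoly_injOn S.2 T.2 (congrArg Subtype.val h)), fun f => by
      obtain ⟨T, hT⟩ := exists_tensorPoly_eq f.2
      exact ⟨symmetrize T, Subtype.ext ((tensorPoly_symmetrize T).trans hT)⟩⟩

theorem tensorPoly_symPolyEquiv_symm {d l : ℕ} (f : homogeneousSubmodule (Fin d) ℝ l) :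
    tensorPoly ((symPolyEquiv d l).symm f).1 = f.1 :=
  congrArg Subtype.val ((symPolyEquiv d l).apply_symm_apply f)

theorem exists_symTensor_eq {d l : ℕ} {f : MvPolynomial (Fin d) ℝ} (hf : f.IsHomogeneous l) :
    ∃ T ∈ symTensor d l, tensorPoly T = f :=
  ⟨_, ((symPolyEquiv d l).symm ⟨f, hf⟩).2, tensorPoly_symPolyEquiv_symm _⟩

theorem tensorPoly_outer {d k l : ℕ} (h : k ≤ l) (E : Tensor d k) (u : Tensor d (l - k)) :
    tensorPoly (outer h E u) = tensorPoly E * tensorPoly u := by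
  -- After substituting `l = k + r`, the second factor is still indexed by `Fin (k + r - k)`, so its
  -- slots pass through a cast before being appended.
  obtain ⟨r, rfl⟩ := Nat.exists_eq_add_of_le h
  have hr : k + r - k = r := by omega
  rw [tensorPoly_apply, tensorPoly_apply, tensorPoly_apply, Finset.sum_mul_sum,
    ← Fintype.sum_prod_type']
  let e : (Fin k → Fin d) × (Fin (k + r - k) → Fin d) ≃ (Fin (k + r) → Fin d) :=
    (Equiv.prodCongr (Equiv.refl _) (Equiv.arrowCongr (finCongr hr) (Equiv.refl _))).trans
      (Fin.appendEquiv k r)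
  have h1 : ∀ p s, e p (Fin.castLE h s) = p.1 s := by
    intro p s
    exact Fin.append_left _ _ s
  have h2 : ∀ p (s : Fin (k + r - k)), e p ⟨k + s, Nat.add_lt_of_lt_sub' s.isLt⟩ = p.2 s := by
    intro p s
    exact Fin.append_right p.1 _ (finCongr hr s)
  refine (Fintype.sum_equiv e _ _ fun p => ?_).symm
  have h3 : (∏ s, X (e p s) : MvPolynomial (Fin d) ℝ) =
      (∏ s, X (p.1 s)) * ∏ s, X (p.2 s) := by
    rw [Fin.prod_univ_add]
    congr 1
    · exact Finset.prod_congr rfl fun s _ => by rw [← h1]; rfl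
    · refine (Fintype.prod_equiv (finCongr hr) _ _ fun s => ?_).symm
      rw [← h2]
      rfl
  simp only [outer, LinearMap.mk₂_apply, h1, h2, h3, C_mul]
  ring

/-! ### The Fischer inner product -/

/-- The Fischer pairing `⟨p, q⟩ = (p(∂) q)(0)`. -/
def fischer {d : ℕ} : MvPolynomial (Fin d) ℝ →ₗ[ℝ] MvPolynomial (Fin d) ℝ →ₗ[ℝ] ℝ :=
  (basisMonomials (Fin d) ℝ).constr ℝ fun a => (∏ i, ((a i).factorial : ℝ)) • lcoeff ℝ a

theorem fischer_monomial {d : ℕ} (a : Fin d →₀ ℕ) (c : ℝ) (q : MvPolynomial (Fin d) ℝ) :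
    fischer (monomial a c) q = c * (∏ i, ((a i).factorial : ℝ)) * coeff a q := by
  have h : (monomial a c : MvPolynomial (Fin d) ℝ) = c • basisMonomials (Fin d) ℝ a := by
    simp [smul_monomial]
  rw [h, map_smul, fischer, Module.Basis.constr_basis]
  simp [mul_assoc]

theorem fischer_comm {d : ℕ} (p q : MvPolynomial (Fin d) ℝ) : fischer p q = fischer q p := by
  induction p using MvPolynomial.induction_on' with
  | monomial a c =>
    induction q using MvPolynomial.induction_on' with
    | monomial b c' =>
      rw [fischer_monomial, fischer_monomial, coeff_monomial, coeff_monomial]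
      by_cases h : a = b
      · subst h
        simp only [if_true]
        ring
      · simp [h, Ne.symm h]
    | add q₁ q₂ h₁ h₂ => rw [map_add, map_add, LinearMap.add_apply, h₁, h₂]
  | add p₁ p₂ h₁ h₂ => rw [map_add, map_add, LinearMap.add_apply, h₁, h₂]

/-- On monomials, raising the exponent `a i` by one multiplies the factorial weight by `a i + 1`,
which is the factor produced by `∂_i` on coefficients. -/
theorem fischer_X_mul {d : ℕ} (i : Fin d) (p q : MvPolynomial (Fin d) ℝ) :
    fischer (X i * p) q = fischer p (pderiv i q) := by
  induction p using MvPolynomial.induction_on' with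
  | monomial a c =>
    rw [X, monomial_mul, one_mul, fischer_monomial, fischer_monomial, coeff_pderiv, add_comm _ a]
    have : (∏ j, (((a + Finsupp.single i 1 : Fin d →₀ ℕ) j).factorial : ℝ)) =
        (a i + 1) * ∏ j, ((a j).factorial : ℝ) := by
      rw [← Finset.mul_prod_erase _ _ (Finset.mem_univ i),
        ← Finset.mul_prod_erase _ (fun j => ((a j).factorial : ℝ)) (Finset.mem_univ i)]
      rw [Finset.prod_congr rfl fun j hj => by
        rw [Finsupp.add_apply, Finsupp.single_eq_of_ne (Finset.ne_of_mem_erase hj), add_zero]]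
      simp [Nat.factorial_succ, mul_assoc]
    rw [this]
    ring
  | add p₁ p₂ h₁ h₂ =>
    rw [mul_add, map_add, map_add, LinearMap.add_apply, LinearMap.add_apply, h₁, h₂]

/-- In the monomial basis the form is diagonal with the positive weights `∏ (a i)!`. -/
theorem fischer_self_eq_zero {d : ℕ} {p : MvPolynomial (Fin d) ℝ} (h : fischer p p = 0) :
    p = 0 := by
  have h1 : fischer p p = ∑ a ∈ p.support, (∏ i, ((a i).factorial : ℝ)) * coeff a p ^ 2 := by
    conv_lhs => enter [1]; rw [p.as_sum]
    rw [map_sum, LinearMap.sum_apply]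
    refine Finset.sum_congr rfl fun a _ => ?_
    rw [fischer_monomial]
    ring
  rw [h1, Finset.sum_eq_zero_iff_of_nonneg fun a _ => by positivity] at h
  ext a
  by_contra ha
  have h2 := h a (mem_support_iff.mpr ha)
  have h3 : 0 < (∏ i, ((a i).factorial : ℝ)) := by positivity
  exact ha (by simpa [h3.ne'] using h2)

theorem fischer_prod_X_mul {d l : ℕ} (J : Fin l → Fin d) (p q : MvPolynomial (Fin d) ℝ) :
    fischer ((∏ s, X (J s)) * p) q = fischer p (iterPderiv l J q) := by
  induction l generalizing q with
  | zero => simp [iterPderiv_zero]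
  | succ l ih =>
    rw [Fin.prod_univ_succ, mul_assoc, fischer_X_mul, iterPderiv_succ]
    exact ih _ _

theorem fischer_tensorPoly_mul {d l : ℕ} (T : Tensor d l) (p q : MvPolynomial (Fin d) ℝ) :
    fischer (tensorPoly T * p) q = fischer p (∑ J, C (T J) * iterPderiv l J q) := by
  rw [tensorPoly_apply, Finset.sum_mul, map_sum, map_sum, LinearMap.sum_apply]
  refine Finset.sum_congr rfl fun J _ => ?_
  rw [← smul_eq_C_mul, ← smul_eq_C_mul, smul_mul_assoc, map_smul, map_smul, LinearMap.smul_apply,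
    fischer_prod_X_mul]

theorem fischer_one {d : ℕ} (q : MvPolynomial (Fin d) ℝ) : fischer 1 q = coeff 0 q := by
  rw [show (1 : MvPolynomial (Fin d) ℝ) = monomial 0 1 from rfl, fischer_monomial]
  simp

theorem fischer_tensorPoly {d l : ℕ} (S : Tensor d l) {T : Tensor d l} (hT : T ∈ symTensor d l) :
    fischer (tensorPoly S) (tensorPoly T) = l.factorial * ∑ J, S J * T J := by
  rw [← mul_one (tensorPoly S), fischer_tensorPoly_mul, fischer_one, coeff_sum, Finset.mul_sum]
  refine Finset.sum_congr rfl fun J _ => ?_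
  rw [iterPderiv_tensorPoly hT, ← C_mul, coeff_zero_C]
  ring

/-! ### The Laplacian and traces -/

/-- The Laplacian of a polynomial. -/
def laplacian {d : ℕ} : MvPolynomial (Fin d) ℝ →ₗ[ℝ] MvPolynomial (Fin d) ℝ :=
  ∑ i, (pderiv i).toLinearMap ∘ₗ (pderiv i).toLinearMap

theorem laplacian_apply {d : ℕ} (f : MvPolynomial (Fin d) ℝ) :
    laplacian f = ∑ i, pderiv i (pderiv i f) := by
  simp [laplacian]

theorem isHomogeneous_laplacian {d l : ℕ} {f : MvPolynomial (Fin d) ℝ} (hf : f.IsHomogeneous l) :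
    (laplacian f).IsHomogeneous (l - 2) := by
  rw [laplacian_apply]
  exact IsHomogeneous.sum _ _ _ fun i _ => hf.pderiv.pderiv

theorem fischer_normSq_mul {d : ℕ} (p q : MvPolynomial (Fin d) ℝ) :
    fischer (normSq d * p) q = fischer p (laplacian q) := by
  rw [normSq, Finset.sum_mul, map_sum, laplacian_apply, map_sum, LinearMap.sum_apply]
  refine Finset.sum_congr rfl fun i _ => ?_
  rw [pow_two, mul_assoc, fischer_X_mul, fischer_X_mul]

theorem laplacian_tensorPoly {d l : ℕ} {T : Tensor d (l + 2)} (hT : T ∈ symTensor d (l + 2)) :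
    laplacian (tensorPoly T) =
      ((l + 2) * (l + 1) : ℝ) • tensorPoly (∑ i, fun J => T (Fin.cons i (Fin.cons i J))) := by
  rw [laplacian_apply, map_sum, Finset.smul_sum]
  refine Finset.sum_congr rfl fun i _ => ?_
  rw [pderiv_tensorPoly hT, Derivation.map_smul, pderiv_tensorPoly (symTensor_cons hT i), smul_smul]
  push_cast
  ring_nf

/-- The Laplacian contracts the first two slots, up to the factor `(l+2)(l+1)`, and for symmetric
tensors this trace stands for all others. In ranks 0 and 1 there is no pair of slots, and the
Laplacian vanishes for reasons of degree. -/
theorem mem_tracelessSym_iff {d l : ℕ} {T : Tensor d l} (hT : T ∈ symTensor d l) :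
    T ∈ tracelessSym d l ↔ laplacian (tensorPoly T) = 0 := by
  match l, T, hT with
  | 0, T, hT =>
    refine ⟨fun _ => ?_, fun _ => ⟨hT, fun s => s.elim0⟩⟩
    simp [tensorPoly_zero_rank, laplacian_apply]
  | 1, T, hT =>
    refine ⟨fun _ => ?_, fun _ => ⟨hT, fun s t hst => absurd (Subsingleton.elim s t) hst⟩⟩
    rw [laplacian_apply]
    exact Finset.sum_eq_zero fun i _ =>
      pderiv_eq_zero_of_isHomogeneous_zero _ (isHomogeneous_tensorPoly T).pderiv
  | l + 2, T, hT =>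
    have hsym : (∑ i, fun J => T (Fin.cons i (Fin.cons i J)) : Tensor d l) ∈ symTensor d l :=
      Submodule.sum_mem _ fun i _ => symTensor_cons (symTensor_cons hT i) i
    have hc : ((l + 2) * (l + 1) : ℝ) ≠ 0 := by positivity
    rw [laplacian_tensorPoly hT, smul_eq_zero_iff_right hc]
    constructor
    · intro h
      have : (∑ i, fun J => T (Fin.cons i (Fin.cons i J)) : Tensor d l) = 0 := by
        funext J
        simp only [Finset.sum_apply, Pi.zero_apply]
        rcases isEmpty_or_nonempty (Fin d) with hd | ⟨⟨c⟩⟩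
        · simp
        rw [← h.2 0 1 (by simp) (Fin.cons c (Fin.cons c J))]
        refine Finset.sum_congr rfl fun i _ => congrArg T ?_
        rw [Fin.update_cons_zero, show (1 : Fin (l + 2)) = Fin.succ 0 from rfl, ← Fin.cons_update,
          Fin.update_cons_zero]
      rw [this, map_zero]
    · intro h
      have h0 := tensorPoly_injOn hsym (zero_mem _) (h.trans (map_zero _).symm)
      refine ⟨hT, fun s t hst J => ?_⟩
      obtain ⟨σ, hσ0, hσ1⟩ : ∃ σ : Equiv.Perm (Fin (l + 2)), σ 0 = s ∧ σ 1 = t := by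
        -- The last transposition sends 0 to `s`; the first, which fixes 0, moves 1 to the slot that
        -- the last one sends to `t`.
        refine ⟨(Equiv.swap 1 (Equiv.swap 0 s t)).trans (Equiv.swap 0 s), ?_, ?_⟩
        · have h1 : (0 : Fin (l + 2)) ≠ Equiv.swap 0 s t := fun h => by
            rw [eq_comm, Equiv.swap_apply_eq_iff, Equiv.swap_apply_left] at h
            exact hst h.symm
          rw [Equiv.trans_apply, Equiv.swap_apply_of_ne_of_ne Fin.zero_ne_one h1,
            Equiv.swap_apply_left]
        · rw [Equiv.trans_apply, Equiv.swap_apply_left, Equiv.swap_apply_self]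
      have := congrFun h0 (fun u => J (σ u.succ.succ))
      simp only [Finset.sum_apply, Pi.zero_apply] at this
      rw [← this]
      refine Finset.sum_congr rfl fun i _ => ?_
      rw [← hT σ]
      congr 1
      funext u
      refine Fin.cases ?_ (fun u => ?_) u
      · simp [hσ0, Function.update_of_ne hst]
      · refine Fin.cases ?_ (fun u => ?_) u
        · rw [Function.comp_apply, show (Fin.succ 0 : Fin (l + 2)) = 1 from rfl, hσ1]
          rw [Function.update_self]
          rfl
        · have ht : σ u.succ.succ ≠ t := fun h => by
            rw [← hσ1] at h
            exact Fin.succ_ne_zero u (Fin.succ_injective _ (σ.injective h))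
          have hs : σ u.succ.succ ≠ s := fun h => by
            rw [← hσ0] at h
            exact Fin.succ_ne_zero _ (σ.injective h)
          simp [Function.update_of_ne ht, Function.update_of_ne hs]

/-! ### Rotations of polynomials -/

/-- The action of a matrix on polynomials that corresponds to its action on symmetric tensors. -/
def rotatePoly {d : ℕ} (g : Matrix (Fin d) (Fin d) ℝ) :
    MvPolynomial (Fin d) ℝ →ₐ[ℝ] MvPolynomial (Fin d) ℝ :=
  aeval fun i => ∑ j, C (g j i) * X j

theorem tensorPoly_rotate {d l : ℕ} (g : Matrix (Fin d) (Fin d) ℝ) (T : Tensor d l) :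
    tensorPoly (rotate g T) = rotatePoly g (tensorPoly T) := by
  rw [tensorPoly_apply, tensorPoly_apply, map_sum]
  simp only [rotate, LinearMap.coe_mk, AddHom.coe_mk, map_sum, Finset.sum_mul, map_mul, map_prod]
  rw [Finset.sum_comm]
  refine Finset.sum_congr rfl fun I _ => ?_
  simp only [rotatePoly, aeval_X, algHom_C, algebraMap_eq]
  rw [Finset.prod_univ_sum, Fintype.piFinset_univ, Finset.mul_sum]
  refine Finset.sum_congr rfl fun J _ => ?_
  rw [Finset.prod_mul_distrib]
  ring

theorem SO_mul_transpose {d : ℕ} (g : SO d) : g.1 * g.1.transpose = 1 :=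
  (Matrix.mem_orthogonalGroup_iff (Fin d) ℝ).mp (Matrix.mem_specialOrthogonalGroup_iff.mp g.2).1

theorem sum_SO_mul {d : ℕ} (g : SO d) (a b : Fin d) :
    ∑ i, g.1 a i * g.1 b i = if a = b then 1 else 0 := by
  have := congrFun (congrFun (SO_mul_transpose g) a) b
  rwa [Matrix.mul_apply, Matrix.one_apply] at this

/-- The position vector is an invariant vector field, since `g gᵀ = 1`. Invariance of `|x|²` and
equivariance of the dilation and special conformal fields rest on it. -/
theorem sum_C_SO_mul_rotatePoly_X {d : ℕ} (g : SO d) (a : Fin d) :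
    ∑ i, C (g.1 a i) * rotatePoly g.1 (X i) = X a := by
  simp only [rotatePoly, aeval_X, Finset.mul_sum]
  rw [Finset.sum_comm]
  simp only [← mul_assoc, ← Finset.sum_mul, ← C_mul, ← map_sum, sum_SO_mul]
  simp

theorem rotatePoly_normSq {d : ℕ} (g : SO d) : rotatePoly g.1 (normSq d) = normSq d := by
  simp only [normSq, map_sum, map_pow]
  have h : ∀ i, rotatePoly g.1 (X i) ^ 2 =
      ∑ j, X j * (C (g.1 j i) * rotatePoly g.1 (X i)) := by
    intro i
    rw [pow_two]
    nth_rewrite 1 [rotatePoly]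
    rw [aeval_X, Finset.sum_mul]
    exact Finset.sum_congr rfl fun j _ => by ring
  rw [Finset.sum_congr rfl fun i _ => h i, Finset.sum_comm]
  simp only [← Finset.mul_sum, sum_C_SO_mul_rotatePoly_X, pow_two]

/-! ### Tensors with a charge index -/

section

variable {d : ℕ} {ι : Type}

variable (d ι) in
/-- `weight` as a linear map. -/
def weightHom (l : ℕ) : momentSpace d ι l →ₗ[ℝ] ι → MvPolynomial (Fin d) ℝ :=
  LinearMap.pi fun a => tensorPoly ∘ₗ LinearMap.proj a ∘ₗ (momentSpace d ι l).subtype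

theorem weight_apply {l : ℕ} (P : momentSpace d ι l) (a : ι) :
    weight P a = tensorPoly (P.1 a) := rfl

theorem weight_add {l : ℕ} (M N : momentSpace d ι l) (a : ι) :
    weight (M + N) a = weight M a + weight N a :=
  congrFun (map_add (weightHom d ι l) M N) a

theorem weight_smul {l : ℕ} (c : ℝ) (M : momentSpace d ι l) (a : ι) :
    weight (c • M) a = c • weight M a :=
  congrFun (map_smul (weightHom d ι l) c M) a

theorem isHomogeneous_weight {l : ℕ} (P : momentSpace d ι l) (a : ι) :
    (weight P a).IsHomogeneous l := isHomogeneous_tensorPoly _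

theorem momentSpace_mem {l : ℕ} (P : momentSpace d ι l) (a : ι) : P.1 a ∈ symTensor d l :=
  P.2 a (Set.mem_univ a)

theorem weight_injective {l : ℕ} : Function.Injective (weight (d := d) (ι := ι) (l := l)) := by
  intro P Q h
  refine Subtype.ext (funext fun a => ?_)
  have h1 : tensorPoly (P.1 a) = tensorPoly (Q.1 a) := congrFun h a
  exact tensorPoly_injOn (momentSpace_mem P a) (momentSpace_mem Q a) h1

variable (d ι) in
/-- The inverse of `weight`. -/
def weightInv (l : ℕ) (f : ι → MvPolynomial (Fin d) ℝ) (hf : ∀ a, (f a).IsHomogeneous l) :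
    momentSpace d ι l :=
  ⟨fun a => ((symPolyEquiv d l).symm ⟨f a, hf a⟩).1, fun _ _ => Subtype.property _⟩

theorem weight_weightInv {l : ℕ} (f : ι → MvPolynomial (Fin d) ℝ)
    (hf : ∀ a, (f a).IsHomogeneous l) : weight (weightInv d ι l f hf) = f :=
  funext fun _ => tensorPoly_symPolyEquiv_symm _

variable [Fintype ι]

theorem sum_fischer_weight {l : ℕ} (P M : momentSpace d ι l) :
    ∑ a, fischer (weight P a) (weight M a) = l.factorial * momentInner P M := by
  simp only [weight_apply, fischer_tensorPoly _ (momentSpace_mem M _), momentInner,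
    ← Finset.mul_sum]

/-- The inner product on `S ⊗ □^{⊙l}` as a bilinear form. -/
def momentForm (l : ℕ) : LinearMap.BilinForm ℝ (momentSpace d ι l) :=
  LinearMap.mk₂ ℝ momentInner
    (by intros; simp [momentInner, add_mul, Finset.sum_add_distrib])
    (by intros; simp [momentInner, mul_assoc, Finset.mul_sum])
    (by intros; simp [momentInner, mul_add, Finset.sum_add_distrib])
    (by intros; simp [momentInner, mul_left_comm, Finset.mul_sum])

theorem momentForm_apply {l : ℕ} (P M : momentSpace d ι l) :
    momentForm l P M = momentInner P M := rfl

theorem momentInner_comm {l : ℕ} (P M : momentSpace d ι l) :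
    momentInner P M = momentInner M P := by
  simp only [momentInner, mul_comm]

theorem eq_zero_of_momentInner_self {l : ℕ} {P : momentSpace d ι l} (h : momentInner P P = 0) :
    P = 0 := by
  have h1 := (Finset.sum_eq_zero_iff_of_nonneg fun a _ =>
    Finset.sum_nonneg fun J _ => mul_self_nonneg (P.1 a J)).mp h
  refine Subtype.ext <| funext fun a => funext fun J => ?_
  have h2 := (Finset.sum_eq_zero_iff_of_nonneg fun J _ => mul_self_nonneg (P.1 a J)).mp
    (h1 a (Finset.mem_univ a)) J (Finset.mem_univ J)
  exact mul_self_eq_zero.mp h2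

/-- Positive definiteness makes a subspace disjoint from its orthogonal, which suffices in finite
dimension. -/
theorem isCompl_orthogonal_momentForm {l : ℕ} (N : Submodule ℝ (momentSpace d ι l)) :
    IsCompl N ((momentForm l).orthogonal N) := by
  rw [LinearMap.BilinForm.isCompl_orthogonal_iff_disjoint]
  · rw [Submodule.disjoint_def]
    intro P hP hP'
    exact eq_zero_of_momentInner_self (hP' P hP)
  · intro P M h
    rw [momentForm_apply, momentInner_comm]
    exact h

end

/-! ### The adjoint of `Z` as a differential operator -/

section

variable {d p k : ℕ} {ι : Type} [Fintype ι] [DecidableEq ι] (G : GaussLaw d p k ι)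

/-- The polynomial `Y_A^{i_1 … i_k a} E^A ∂_{i_1} ⋯ ∂_{i_k} f_a`, for a constant field `E`. -/
def gaussOp (E : Tensor d p) (f : ι → MvPolynomial (Fin d) ℝ) : MvPolynomial (Fin d) ℝ :=
  ∑ a, ∑ I : Fin k → Fin d, C (G.coeff E a I) * iterPderiv k I (f a)

theorem isHomogeneous_gaussOp {l : ℕ} (E : Tensor d p) {f : ι → MvPolynomial (Fin d) ℝ}
    (hf : ∀ a, (f a).IsHomogeneous l) : (gaussOp G E f).IsHomogeneous (l - k) :=
  IsHomogeneous.sum _ _ _ fun a _ => IsHomogeneous.sum _ _ _ fun I _ =>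
    (isHomogeneous_iterPderiv I (hf a)).C_mul _

theorem gaussOp_eq_zero_of_lt {l : ℕ} (h : l < k) (E : Tensor d p)
    {f : ι → MvPolynomial (Fin d) ℝ} (hf : ∀ a, (f a).IsHomogeneous l) : gaussOp G E f = 0 :=
  Finset.sum_eq_zero fun a _ => Finset.sum_eq_zero fun I _ => by
    rw [iterPderiv_eq_zero h I (hf a), mul_zero]

theorem weight_Z {l : ℕ} (h : k ≤ l) (E : G.electric) (u : symTensor d (l - k)) (a : ι) :
    weight (Z G h (E ⊗ₜ u)) a = tensorPoly (G.coeff E.1 a) * tensorPoly u.1 := by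
  rw [← tensorPoly_outer h, ← tensorPoly_symmetrize]
  rfl

/-- The adjointness of `Z` and `gaussOp`: multiplication by the polynomial of `Y_A E^A` becomes the
corresponding constant-coefficient differential operator. -/
theorem sum_fischer_weight_Z {l : ℕ} (h : k ≤ l) (E : G.electric) (u : symTensor d (l - k))
    (f : ι → MvPolynomial (Fin d) ℝ) :
    ∑ a, fischer (weight (Z G h (E ⊗ₜ u)) a) (f a) =
      fischer (tensorPoly u.1) (gaussOp G E.1 f) := by
  simp only [weight_Z, fischer_tensorPoly_mul, gaussOp, map_sum]

theorem imZ_of_le {l : ℕ} (h : k ≤ l) : imZ G l = LinearMap.range (Z G h) := by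
  rw [imZ, iSup_pos h]

theorem imZ_of_lt {l : ℕ} (h : l < k) : imZ G l = ⊥ := by
  rw [imZ, iSup_neg (not_le.mpr h)]

/-- `P` is orthogonal to the image of `Z` iff the polynomials with coefficients `P` solve the
adjoint equation. -/
theorem orthogonal_imZ_iff {l : ℕ} (P : momentSpace d ι l) :
    (∀ M ∈ imZ G l, momentInner P M = 0) ↔ ∀ E ∈ G.electric, gaussOp G E (weight P) = 0 := by
  rcases lt_or_ge l k with h | h
  · refine iff_of_true (fun M hM => ?_) fun E _ =>
      gaussOp_eq_zero_of_lt G h E (isHomogeneous_weight P)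
    rw [imZ_of_lt G h, Submodule.mem_bot] at hM
    rw [hM, ← momentForm_apply, map_zero]
  · rw [imZ_of_le G h]
    have hl : (l.factorial : ℝ) ≠ 0 := by positivity
    constructor
    · intro hP E hE
      -- Taking for `u` the tensor of `gaussOp G E (weight P)` itself turns the pairing into a
      -- Fischer norm, which must vanish.
      obtain ⟨u, hu, hu'⟩ := exists_symTensor_eq
        (isHomogeneous_gaussOp G E (isHomogeneous_weight P))
      have h1 := sum_fischer_weight_Z G h ⟨E, hE⟩ ⟨u, hu⟩ (weight P)
      rw [sum_fischer_weight, momentInner_comm, hP _ ⟨_, rfl⟩, mul_zero] at h1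
      simp only [hu'] at h1
      exact fischer_self_eq_zero h1.symm
    · rintro hP _ ⟨t, rfl⟩
      induction t using TensorProduct.induction_on with
      | zero => rw [map_zero, ← momentForm_apply, map_zero]
      | tmul E u =>
        have h1 := sum_fischer_weight_Z G h E u (weight P)
        rw [sum_fischer_weight, hP _ E.2, map_zero, momentInner_comm] at h1
        exact (mul_eq_zero.mp h1).resolve_left hl
      | add s t hs ht =>
        rw [map_add, ← momentForm_apply, map_add, momentForm_apply, momentForm_apply, hs, ht,
          add_zero]

theorem mem_orthogonal_imZ_iff {l : ℕ} (P : momentSpace d ι l) :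
    P ∈ (momentForm l).orthogonal (imZ G l) ↔ ∀ E ∈ G.electric, gaussOp G E (weight P) = 0 := by
  rw [← orthogonal_imZ_iff]
  refine forall₂_congr fun M _ => ?_
  rw [momentInner_comm]
  rfl

/-- The cokernel is isomorphic to `(im Z)^⊥`, whose elements are the coefficient tensors of the
solutions. -/
theorem nontrivial_cokerZ_iff (l : ℕ) :
    Nontrivial (cokerZ G l) ↔ ∃ f : ι → MvPolynomial (Fin d) ℝ, (∀ a, (f a).IsHomogeneous l) ∧
      f ≠ 0 ∧ ∀ E ∈ G.electric, gaussOp G E f = 0 := by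
  rw [(Submodule.quotientEquivOfIsCompl _ _
    (isCompl_orthogonal_momentForm (imZ G l))).toEquiv.nontrivial_congr,
    Submodule.nontrivial_iff_ne_bot, Submodule.ne_bot_iff]
  constructor
  · rintro ⟨P, hP, hP0⟩
    exact ⟨weight P, isHomogeneous_weight P, fun h => hP0 (weight_injective
      (h.trans (map_zero (weightHom d ι l)).symm)), (mem_orthogonal_imZ_iff G P).mp hP⟩
  · rintro ⟨f, hf, hf0, hfE⟩
    refine ⟨weightInv d ι l f hf, ?_, fun h => hf0 ?_⟩
    · rwa [mem_orthogonal_imZ_iff, weight_weightInv]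
    · rw [← weight_weightInv f hf, h]
      exact map_zero (weightHom d ι l)

/-! ### Equivariance -/

theorem weight_momentRotate {l : ℕ} (g : SO d) (M : momentSpace d ι l) (a : ι) :
    weight (momentRotate G l g M) a =
      ∑ b, C (G.chargeRep g a b) * rotatePoly g.1 (weight M b) := by
  rw [weight_apply, momentRotate, map_sum]
  refine Finset.sum_congr rfl fun b _ => ?_
  rw [map_smul, tensorPoly_rotate, smul_eq_C_mul, weight_apply]

theorem momentRotate_add {l : ℕ} (g : SO d) (M N : momentSpace d ι l) :
    momentRotate G l g (M + N) = momentRotate G l g M + momentRotate G l g N := by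
  apply weight_injective
  funext a
  simp only [weight_momentRotate, weight_add, map_add, mul_add, Finset.sum_add_distrib]

theorem momentRotate_zero {l : ℕ} (g : SO d) : momentRotate G l g 0 = 0 := by
  have h := momentRotate_add G g (0 : momentSpace d ι l) 0
  rwa [add_zero, left_eq_add] at h

/-- `Z` intertwines the rotations on pure tensors, by the equivariance of the coefficients `Y`;
hence the rotations descend to the cokernel. -/
theorem momentRotate_mem_imZ {l : ℕ} (g : SO d) {M : momentSpace d ι l} (hM : M ∈ imZ G l) :
    momentRotate G l g M ∈ imZ G l := by
  rcases lt_or_ge l k with h | h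
  · rw [imZ_of_lt G h, Submodule.mem_bot] at hM ⊢
    rw [hM, momentRotate_zero]
  · rw [imZ_of_le G h] at hM ⊢
    obtain ⟨t, rfl⟩ := hM
    induction t using TensorProduct.induction_on with
    | zero => rw [map_zero, momentRotate_zero]; exact zero_mem _
    | tmul E u =>
      refine ⟨⟨_, G.electric_rotate g E.1 E.2⟩ ⊗ₜ ⟨_, rotate_mem_symTensor g.1 u.2⟩, ?_⟩
      apply weight_injective
      funext a
      rw [weight_Z, weight_momentRotate, G.coeff_rotate g E.1 E.2, map_sum, Finset.sum_mul]
      refine Finset.sum_congr rfl fun b _ => ?_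
      rw [weight_Z, map_smul, tensorPoly_rotate, tensorPoly_rotate, map_mul, smul_eq_C_mul,
        mul_assoc]
    | add s t hs ht =>
      rw [map_add, momentRotate_add]
      exact add_mem hs ht

/-- If the polynomial solutions of the adjoint equation of degree `l` are parametrised linearly and
equivariantly by `W`, then the cokernel of `Z` is equivariantly isomorphic to `W`. -/
theorem exists_cokerZ_equiv {l : ℕ} {W : Type*} [AddCommGroup W] [Module ℝ W]
    (φ : W →ₗ[ℝ] ι → MvPolynomial (Fin d) ℝ) (hinj : Function.Injective φ)
    (hhom : ∀ w a, (φ w a).IsHomogeneous l)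
    (hsol : ∀ f : ι → MvPolynomial (Fin d) ℝ, (∀ a, (f a).IsHomogeneous l) →
      ((∀ E ∈ G.electric, gaussOp G E f = 0) ↔ ∃ w, φ w = f)) :
    ∃ e : cokerZ G l ≃ₗ[ℝ] W, ∀ (g : SO d) (act : W → W),
      (∀ w a, φ (act w) a = ∑ b, C (G.chargeRep g a b) * rotatePoly g.1 (φ w b)) →
      ∀ M, e (Submodule.Quotient.mk (momentRotate G l g M)) =
        act (e (Submodule.Quotient.mk M)) := by
  let j₀ : W →ₗ[ℝ] momentSpace d ι l :=
    { toFun := fun w => weightInv d ι l (φ w) (hhom w)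
      map_add' := fun v w => weight_injective <| funext fun a => by
        rw [weight_add, weight_weightInv, weight_weightInv, weight_weightInv, map_add, Pi.add_apply]
      map_smul' := fun c w => weight_injective <| funext fun a => by
        rw [RingHom.id_apply, weight_smul, weight_weightInv, weight_weightInv, map_smul,
          Pi.smul_apply] }
  have hj₀ : ∀ w, weight (j₀ w) = φ w := fun w => weight_weightInv _ _
  have hmem : ∀ w, j₀ w ∈ (momentForm l).orthogonal (imZ G l) := fun w => by
    rw [mem_orthogonal_imZ_iff, hj₀]
    exact (hsol _ (hhom w)).mpr ⟨w, rfl⟩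
  have hbij : Function.Bijective (j₀.codRestrict _ hmem) := by
    constructor
    · intro v w h
      apply hinj
      rw [← hj₀, ← hj₀, show j₀ v = j₀ w from congrArg Subtype.val h]
    · intro P
      obtain ⟨w, hw⟩ := (hsol _ (isHomogeneous_weight P.1)).mp
        ((mem_orthogonal_imZ_iff G P.1).mp P.2)
      exact ⟨w, Subtype.ext (weight_injective ((hj₀ w).trans hw))⟩
  let j := LinearEquiv.ofBijective (j₀.codRestrict _ hmem) hbij
  have hc := isCompl_orthogonal_momentForm (imZ G l)
  let e := (Submodule.quotientEquivOfIsCompl _ _ hc).trans j.symm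
  have hsymm : ∀ w, e.symm w = Submodule.Quotient.mk (j₀ w) := fun w =>
    Submodule.quotientEquivOfIsCompl_symm_apply _ _ hc (j w)
  refine ⟨e, fun g act hact M => ?_⟩
  -- Each class has a representative `j₀ w` orthogonal to the image. Rotating `M` and `j₀ w` keeps
  -- their difference in `im Z`, and the intertwining hypothesis turns the rotated `j₀ w` into `j₀
  -- (act w)`.
  obtain ⟨w, hw⟩ := e.symm.surjective (Submodule.Quotient.mk M)
  rw [← hw, e.apply_symm_apply, ← e.eq_symm_apply, hsymm]
  rw [hsymm, eq_comm, Submodule.Quotient.eq] at hw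
  have h1 : j₀ (act w) = momentRotate G l g (j₀ w) := by
    apply weight_injective
    funext a
    rw [hj₀, hact, weight_momentRotate, hj₀]
  rw [h1, Submodule.Quotient.eq]
  have h2 := momentRotate_mem_imZ G g hw
  have h3 := momentRotate_add G g (M - j₀ w) (j₀ w)
  rw [sub_add_cancel] at h3
  rwa [h3, add_sub_cancel_right]

end

/-! ### Derivatives of polynomial functions -/

theorem hasFDerivAt_eval {d : ℕ} (f : MvPolynomial (Fin d) ℝ) (x : Fin d → ℝ) :
    HasFDerivAt (fun y => eval y f)
      (∑ i, eval x (pderiv i f) • ContinuousLinearMap.proj (R := ℝ) (φ := fun _ : Fin d => ℝ) i)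
      x := by
  induction f using MvPolynomial.induction_on with
  | C c =>
    simp only [eval_C, pderiv_C, map_zero, zero_smul, Finset.sum_const_zero]
    exact hasFDerivAt_const c x
  | add p q hp hq =>
    simp only [map_add, add_smul, Finset.sum_add_distrib]
    exact hp.add hq
  | mul_X p n hp =>
    simp only [map_mul, eval_X]
    refine (hp.mul (hasFDerivAt_apply n x)).congr_fderiv ?_
    ext v
    simp only [add_apply, smul_apply,
      sum_apply, ContinuousLinearMap.proj_apply, smul_eq_mul, pderiv_mul,
      pderiv_X, map_add, map_mul, eval_X, add_mul, Finset.sum_add_distrib]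
    rw [add_comm, Finset.mul_sum]
    congr 1
    · exact Finset.sum_congr rfl fun i _ => by ring
    · simp [Pi.single_apply, apply_ite]

theorem contDiff_eval {d : ℕ} (f : MvPolynomial (Fin d) ℝ) :
    ContDiff ℝ ∞ fun x => eval x f := by
  induction f using MvPolynomial.induction_on with
  | C c => simpa using contDiff_const
  | add p q hp hq => simpa using hp.add hq
  | mul_X p n hp => simpa using hp.mul (contDiff_apply ℝ ℝ n)

theorem fderiv_eval {d : ℕ} (f : MvPolynomial (Fin d) ℝ) (x : Fin d → ℝ) (i : Fin d) :
    fderiv ℝ (fun y => eval y f) x (Pi.single i 1) = eval x (pderiv i f) := by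
  rw [(hasFDerivAt_eval f x).fderiv]
  simp [Pi.single_apply]

/-! ### The divergence theorem on boxes -/

/-- Faces are indexed here by the coordinates `j ≠ i`, whereas the divergence theorem used below
indexes them by `Fin n`; `succAbove` gives a measure-preserving change between the two. -/
theorem integral_face_eq {n : ℕ} (i : Fin (n + 1)) (a b : Fin (n + 1) → ℝ) (c : ℝ)
    (F : (Fin (n + 1) → ℝ) → ℝ) :
    ∫ y in Set.Icc (fun j : {j : Fin (n + 1) // j ≠ i} => a j) (fun j => b j),
        F (fun j => if h : j = i then c else y ⟨j, h⟩) =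
      ∫ y in Set.Icc (a ∘ i.succAbove) (b ∘ i.succAbove), F (i.insertNth c y) := by
  have hmp := volume_measurePreserving_piCongrLeft (fun _ : {j : Fin (n + 1) // j ≠ i} => ℝ)
    (finSuccAboveEquiv i)
  have hval : ∀ (y : Fin n → ℝ) (j : Fin n),
      MeasurableEquiv.piCongrLeft (fun _ : {j : Fin (n + 1) // j ≠ i} => ℝ)
        (finSuccAboveEquiv i) y ⟨i.succAbove j, i.succAbove_ne j⟩ = y j :=
    fun y j => Equiv.piCongrLeft_apply_apply (fun _ : {j : Fin (n + 1) // j ≠ i} => ℝ)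
      (finSuccAboveEquiv i) y j
  rw [← hmp.setIntegral_preimage_emb (MeasurableEquiv.measurableEmbedding _)]
  congr 1
  · congr 1
    ext y
    simp only [Set.mem_preimage, Set.mem_Icc, Pi.le_def, Function.comp_apply]
    refine and_congr ⟨fun h j => ?_, fun h j => ?_⟩ ⟨fun h j => ?_, fun h j => ?_⟩
    · have := h ⟨i.succAbove j, i.succAbove_ne j⟩
      rwa [hval] at this
    · obtain ⟨j, hj⟩ := j
      obtain ⟨j, rfl⟩ := Fin.exists_succAbove_eq hj
      rw [hval]
      exact h j
    · have := h ⟨i.succAbove j, i.succAbove_ne j⟩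
      rwa [hval] at this
    · obtain ⟨j, hj⟩ := j
      obtain ⟨j, rfl⟩ := Fin.exists_succAbove_eq hj
      rw [hval]
      exact h j
  · funext y
    congr 1
    funext j
    by_cases h : j = i
    · subst h
      simp
    · obtain ⟨j, rfl⟩ := Fin.exists_succAbove_eq h
      rw [dif_neg h, hval, Fin.insertNth_apply_succAbove]

theorem integral_divergence_eq_boundaryFlux {d : ℕ} (hd : 0 < d) {a b : Fin d → ℝ}
    (hab : ∀ i, a i < b i) {F : (Fin d → ℝ) → Fin d → ℝ} (hF : ContDiff ℝ ∞ F) :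
    ∫ x in Set.Icc a b, ∑ i, fderiv ℝ (fun y => F y i) x (Pi.single i 1) =
      boundaryFlux a b F := by
  obtain ⟨n, rfl⟩ := Nat.exists_eq_succ_of_ne_zero hd.ne'
  have hFi : ∀ i, ContDiff ℝ ∞ fun y => F y i := fun i => contDiff_pi.mp hF i
  rw [integral_divergence_of_hasFDerivAt_off_countable' a b (fun i => (hab i).le)
    (fun i y => F y i) (fun i x => fderiv ℝ (fun y => F y i) x) ∅ Set.countable_empty
    (fun i => (hFi i).continuous.continuousOn)
    (fun x _ i => ((hFi i).differentiable (by simp) x).hasFDerivAt)]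
  · rw [boundaryFlux]
    refine Finset.sum_congr rfl fun i _ => ?_
    rw [integral_face_eq i a b (b i) fun x => F x i, integral_face_eq i a b (a i) fun x => F x i]
  · refine Continuous.integrableOn_Icc ?_
    exact continuous_finsetSum _ fun i _ =>
      ((hFi i).continuous_fderiv (by simp)).clm_apply continuous_const

/-- The flux only sees values on the faces; this is what makes cutoff fields invisible to it. -/
theorem boundaryFlux_congr {d : ℕ} {a b : Fin d → ℝ} {F F' : (Fin d → ℝ) → Fin d → ℝ}
    (h : ∀ x i, (x i = a i ∨ x i = b i) → F x = F' x) :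
    boundaryFlux a b F = boundaryFlux a b F' := by
  refine Finset.sum_congr rfl fun i _ => ?_
  congr 1
  · congr 1
    funext y
    rw [h _ i (Or.inr (by simp))]
  · congr 1
    funext y
    rw [h _ i (Or.inl (by simp))]

/-! ### Integration by parts -/

/-- The derivatives of order at most `N` of a field. -/
def jet {d p : ℕ} (N : ℕ) (E : (Fin d → ℝ) → Tensor d p) (x : Fin d → ℝ) : Jet d p N :=
  fun m => iteratedFDeriv ℝ m E x

theorem contDiff_jet {d p : ℕ} (N : ℕ) {E : (Fin d → ℝ) → Tensor d p} (hE : ContDiff ℝ ∞ E) :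
    ContDiff ℝ ∞ (jet N E) :=
  contDiff_pi.mpr fun m => hE.iteratedFDeriv_right (m := ∞) (i := m) (by exact_mod_cast le_top)

theorem contDiff_flux {d p N : ℕ} {Φ : (Fin d → ℝ) × Jet d p N → Fin d → ℝ}
    (hΦ : ContDiff ℝ ∞ Φ) {E : (Fin d → ℝ) → Tensor d p} (hE : ContDiff ℝ ∞ E) :
    ContDiff ℝ ∞ fun x => Φ (x, jet N E x) :=
  hΦ.comp (contDiff_id.prodMk (contDiff_jet N hE))

theorem differentiable_flux {d p N : ℕ} {Φ : (Fin d → ℝ) × Jet d p N → Fin d → ℝ}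
    (hΦ : ContDiff ℝ ∞ Φ) {E : (Fin d → ℝ) → Tensor d p} (hE : ContDiff ℝ ∞ E) (i : Fin d) :
    Differentiable ℝ fun x => Φ (x, jet N E x) i :=
  (contDiff_pi.mp (contDiff_flux hΦ hE) i).differentiable (by simp)

/-- The densities that are, for every smooth field, the divergence of a local flux. -/
def localDivergence (d p N : ℕ) : Submodule ℝ (((Fin d → ℝ) → Tensor d p) → (Fin d → ℝ) → ℝ) where
  carrier := {ρ | ∃ Φ : (Fin d → ℝ) × Jet d p N → Fin d → ℝ, ContDiff ℝ ∞ Φ ∧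
    ∀ E, ContDiff ℝ ∞ E → ∀ x,
      ρ E x = ∑ i, fderiv ℝ (fun y => Φ (y, jet N E y) i) x (Pi.single i 1)}
  zero_mem' := ⟨0, contDiff_const, fun E _ x => by simp⟩
  add_mem' := by
    rintro ρ ρ' ⟨Φ, hΦ, h⟩ ⟨Φ', hΦ', h'⟩
    refine ⟨Φ + Φ', hΦ.add hΦ', fun E hE x => ?_⟩
    rw [Pi.add_apply, Pi.add_apply, h E hE, h' E hE, ← Finset.sum_add_distrib]
    refine Finset.sum_congr rfl fun i _ => ?_
    rw [← add_apply, ← fderiv_add (differentiable_flux hΦ hE i x)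
      (differentiable_flux hΦ' hE i x)]
    rfl
  smul_mem' := by
    rintro c ρ ⟨Φ, hΦ, h⟩
    refine ⟨c • Φ, hΦ.const_smul c, fun E hE x => ?_⟩
    rw [Pi.smul_apply, Pi.smul_apply, h E hE, Finset.smul_sum]
    refine Finset.sum_congr rfl fun i _ => ?_
    rw [← smul_apply, ← fderiv_const_smul (differentiable_flux hΦ hE i x)]
    rfl

theorem localDivergence_congr {d p N : ℕ} {ρ ρ' : ((Fin d → ℝ) → Tensor d p) → (Fin d → ℝ) → ℝ}
    (h : ρ ∈ localDivergence d p N) (hρ : ∀ E, ContDiff ℝ ∞ E → ∀ x, ρ' E x = ρ E x) :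
    ρ' ∈ localDivergence d p N := by
  obtain ⟨Φ, hΦ, h⟩ := h
  exact ⟨Φ, hΦ, fun E hE x => (hρ E hE x).trans (h E hE x)⟩

theorem integral_localDivergence {d p N : ℕ} (hd : 0 < d)
    {ρ : ((Fin d → ℝ) → Tensor d p) → (Fin d → ℝ) → ℝ} (hρ : ρ ∈ localDivergence d p N) :
    ∃ Φ : (Fin d → ℝ) × Jet d p N → Fin d → ℝ, ContDiff ℝ ∞ Φ ∧
      ∀ E, ContDiff ℝ ∞ E → ∀ a b : Fin d → ℝ, (∀ i, a i < b i) →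
        ∫ x in Set.Icc a b, ρ E x = boundaryFlux a b fun x => Φ (x, jet N E x) := by
  obtain ⟨Φ, hΦ, h⟩ := hρ
  refine ⟨Φ, hΦ, fun E hE a b hab => ?_⟩
  rw [← integral_divergence_eq_boundaryFlux hd hab (contDiff_flux hΦ hE)]
  simp only [h E hE]

/-- The iterated partial derivative `∂_{i_1} ⋯ ∂_{i_k} (L E)`. -/
def partialDeriv {d p k : ℕ} (L : Tensor d p →ₗ[ℝ] ℝ) (I : Fin k → Fin d)
    (E : (Fin d → ℝ) → Tensor d p) (x : Fin d → ℝ) : ℝ :=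
  iteratedFDeriv ℝ k (fun y => L (E y)) x fun s => Pi.single (I s) 1

theorem contDiff_linear_field {d p : ℕ} (L : Tensor d p →ₗ[ℝ] ℝ)
    {E : (Fin d → ℝ) → Tensor d p} (hE : ContDiff ℝ ∞ E) : ContDiff ℝ ∞ fun y => L (E y) :=
  (LinearMap.toContinuousLinearMap L).contDiff.comp hE

theorem contDiff_partialDeriv {d p k : ℕ} (L : Tensor d p →ₗ[ℝ] ℝ) (I : Fin k → Fin d)
    {E : (Fin d → ℝ) → Tensor d p} (hE : ContDiff ℝ ∞ E) :
    ContDiff ℝ ∞ (partialDeriv L I E) :=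
  (ContinuousMultilinearMap.apply ℝ (fun _ : Fin k => Fin d → ℝ) ℝ
    fun s => Pi.single (I s) 1).contDiff.comp
    ((contDiff_linear_field L hE).iteratedFDeriv_right (m := ∞) (i := k) (by exact_mod_cast le_top))

theorem partialDeriv_eq {d p k : ℕ} (L : Tensor d p →ₗ[ℝ] ℝ) (I : Fin k → Fin d)
    {E : (Fin d → ℝ) → Tensor d p} (hE : ContDiff ℝ ∞ E) (x : Fin d → ℝ) :
    partialDeriv L I E x = L (iteratedFDeriv ℝ k E x fun s => Pi.single (I s) 1) := by
  have := (LinearMap.toContinuousLinearMap L).iteratedFDeriv_comp_left (i := k)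
    hE.contDiffAt (x := x) (by exact_mod_cast le_top)
  exact congrArg (fun m => m fun s => Pi.single (I s) 1) this

theorem partialDeriv_succ {d p k : ℕ} (L : Tensor d p →ₗ[ℝ] ℝ) (I : Fin (k + 1) → Fin d)
    {E : (Fin d → ℝ) → Tensor d p} (hE : ContDiff ℝ ∞ E) (x : Fin d → ℝ) :
    partialDeriv L I E x =
      fderiv ℝ (partialDeriv L (Fin.tail I) E) x (Pi.single (I 0) 1) := by
  rw [partialDeriv, iteratedFDeriv_succ_apply_left]
  have hd : DifferentiableAt ℝ (iteratedFDeriv ℝ k fun y => L (E y)) x :=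
    ((contDiff_linear_field L hE).iteratedFDeriv_right (m := ∞) (i := k)
      (by exact_mod_cast le_top)).differentiable
      (by simp) x
  have h := ((ContinuousMultilinearMap.apply ℝ (fun _ : Fin k => Fin d → ℝ) ℝ
    fun s => Pi.single (Fin.tail I s) 1).hasFDerivAt.comp x hd.hasFDerivAt).fderiv
  exact (congrArg (fun m => m (Pi.single (I 0) 1)) h).symm

/-- Leibniz: `f ∂_i g = ∂_i (f g) - (∂_i f) g`, with `g` the remaining derivatives of `L E`, then
induction on `g` with weight `∂_i f`. The fluxes involve at most `k - 1` derivatives of `E`, hence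
the bound `k ≤ N + 1`. -/
theorem partialDeriv_by_parts {d p N : ℕ} (L : Tensor d p →ₗ[ℝ] ℝ) {k : ℕ} (hk : k ≤ N + 1)
    (I : Fin k → Fin d) (f : MvPolynomial (Fin d) ℝ) :
    (fun E x => eval x f * partialDeriv L I E x -
      (-1) ^ k * (eval x (iterPderiv k I f) * L (E x))) ∈ localDivergence d p N := by
  induction k generalizing f with
  | zero =>
    refine localDivergence_congr (zero_mem _) fun E _ x => ?_
    simp [partialDeriv, iterPderiv_zero]
  | succ k ih =>
    have h1 : (fun E x => fderiv ℝ (fun y => eval y f * partialDeriv L (Fin.tail I) E y) x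
        (Pi.single (I 0) 1)) ∈ localDivergence d p N := by
      -- The flux points along `I 0` and is `f` times the remaining `k` derivatives of `L E`, read
      -- off from the jet.
      refine ⟨fun q => Pi.single (I 0) (eval q.1 f *
        L (q.2 ⟨k, by omega⟩ fun s => Pi.single (Fin.tail I s) 1)), ?_, fun E hE x => ?_⟩
      · refine (ContinuousLinearMap.single ℝ (fun _ : Fin d => ℝ) (I 0)).contDiff.comp ?_
        refine ((contDiff_eval f).comp contDiff_fst).mul ?_
        refine (LinearMap.toContinuousLinearMap L).contDiff.comp ?_
        refine (ContinuousMultilinearMap.apply ℝ (fun _ : Fin k => Fin d → ℝ) (Tensor d p)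
          fun s => Pi.single (Fin.tail I s) 1).contDiff.comp ?_
        exact (contDiff_pi.mp contDiff_id (⟨k, by omega⟩ : Fin (N + 1))).comp contDiff_snd
      · rw [Finset.sum_eq_single (I 0)]
        · simp only [Pi.single_eq_same]
          congr 2
          funext y
          rw [partialDeriv_eq L _ hE]
          rfl
        · intro i _ hi
          simp [Pi.single_eq_of_ne hi]
        · simp
    refine localDivergence_congr (sub_mem h1 (ih (by omega) (Fin.tail I) (pderiv (I 0) f)))
      fun E hE x => ?_
    simp only [Pi.sub_apply]
    have h2 := ((hasFDerivAt_eval f x).differentiableAt.hasFDerivAt.mul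
      ((contDiff_partialDeriv L (Fin.tail I) hE).differentiable (by simp) x).hasFDerivAt).fderiv
    rw [partialDeriv_succ L I hE, iterPderiv_succ]
    erw [h2]
    simp only [add_apply, smul_apply, smul_eq_mul,
      fderiv_eval]
    ring

/-! ### Conserved moments -/

section

variable {d p k : ℕ} {ι : Type} [Fintype ι] [DecidableEq ι] (G : GaussLaw d p k ι)

theorem eval_gaussOp (E : Tensor d p) (f : ι → MvPolynomial (Fin d) ℝ) (x : Fin d → ℝ) :
    eval x (gaussOp G E f) =
      ∑ c, ∑ I : Fin k → Fin d, G.coeff E c I * eval x (iterPderiv k I (f c)) := by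
  simp [gaussOp, map_sum]

/-- The component `Y_A^{i_1 … i_k a} E^A`, as a linear form in `E`. -/
def coeffForm (c : ι) (I : Fin k → Fin d) : Tensor d p →ₗ[ℝ] ℝ :=
  LinearMap.proj I ∘ₗ LinearMap.proj c ∘ₗ G.coeff

theorem chargeDensity_eq (E : (Fin d → ℝ) → Tensor d p) (c : ι) (x : Fin d → ℝ) :
    chargeDensity G E c x = ∑ I : Fin k → Fin d, partialDeriv (coeffForm G c I) I E x := rfl

theorem moment_by_parts (f : ι → MvPolynomial (Fin d) ℝ) :
    (fun E x => (∑ c, eval x (f c) * chargeDensity G E c x) -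
      (-1) ^ k * eval x (gaussOp G (E x) f)) ∈ localDivergence d p k := by
  refine localDivergence_congr (Submodule.sum_mem (t := Finset.univ) _ fun c _ =>
    Submodule.sum_mem (t := Finset.univ) _ fun I _ =>
    partialDeriv_by_parts (N := k) (coeffForm G c I) (Nat.le_succ k) I (f c)) fun E _ x => ?_
  simp only [Finset.sum_apply, Finset.sum_sub_distrib, eval_gaussOp, chargeDensity_eq,
    Finset.mul_sum]
  congr 1
  refine Finset.sum_congr rfl fun c _ => Finset.sum_congr rfl fun I _ => ?_
  simp only [coeffForm, LinearMap.comp_apply, LinearMap.proj_apply]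
  ring

/-- Once the bulk term vanishes pointwise, integration by parts leaves only a local flux. -/
theorem isConserved_of_gaussOp_eq_zero (hd : 0 < d) {f : ι → MvPolynomial (Fin d) ℝ}
    (hf : ∀ E ∈ G.electric, gaussOp G E f = 0) : IsConserved G f := by
  obtain ⟨Φ, hΦ, h⟩ := integral_localDivergence hd (moment_by_parts G f)
  refine ⟨k, Φ, hΦ, fun E hE hEG a b hab => ?_⟩
  rw [← show _ = boundaryFlux a b fun x => Φ (x, fun m => iteratedFDeriv ℝ m E x) from
    h E hE a b hab]
  simp [hf _ (hEG _)]

theorem chargeDensity_zero (c : ι) (x : Fin d → ℝ) :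
    chargeDensity G (fun _ => 0) c x = 0 := by
  simp only [chargeDensity_eq]
  exact Finset.sum_eq_zero fun I _ => by
    rw [partialDeriv_eq _ _ contDiff_const]
    simp

theorem continuous_chargeDensity {E : (Fin d → ℝ) → Tensor d p} (hE : ContDiff ℝ ∞ E) (c : ι) :
    Continuous (chargeDensity G E c) :=
  continuous_finsetSum _ fun I _ => (contDiff_partialDeriv (coeffForm G c I) I hE).continuous

/-- Fields `χ E₀` with `χ` compactly supported inside a large box agree with the zero field near its
boundary, so neither the given flux nor that from integration by parts detects them. The remaining
bulk integral `∫ χ q` must vanish for every `χ`. -/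
theorem gaussOp_eq_zero_of_isConserved (hd : 0 < d) {f : ι → MvPolynomial (Fin d) ℝ}
    (hf : IsConserved G f) : ∀ E ∈ G.electric, gaussOp G E f = 0 := by
  intro E₀ hE₀
  obtain ⟨N, Φ, hΦ, h⟩ := hf
  obtain ⟨Φ', hΦ', h'⟩ := integral_localDivergence hd (moment_by_parts G f)
  set q := gaussOp G E₀ f with hq
  have hqc : Continuous fun x => eval x q := (contDiff_eval q).continuous
  have hgs : ∀ (c : ℝ) x, eval x (gaussOp G (c • E₀) f) = c * eval x q := by
    intro c x
    simp [hq, eval_gaussOp, Finset.mul_sum, mul_assoc]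
  have key : ∀ χ : (Fin d → ℝ) → ℝ, ContDiff ℝ ∞ χ → HasCompactSupport χ →
      ∫ x, χ x • eval x q = 0 := by
    intro χ hχ hχc
    obtain ⟨R, hR0, hR⟩ := hχc.isBounded.exists_pos_norm_lt
    set a : Fin d → ℝ := fun _ => -R with ha
    set b : Fin d → ℝ := fun _ => R with hb
    have hab : ∀ i, a i < b i := fun i => by simp only [ha, hb]; linarith
    have hE : ContDiff ℝ ∞ fun x => χ x • E₀ := hχ.smul contDiff_const
    have hjet : ∀ M (x : Fin d → ℝ) i, (x i = a i ∨ x i = b i) →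
        jet M (fun x => χ x • E₀) x = jet M (fun _ => (0 : Tensor d p)) x := by
      intro M x i hx
      have hx' : x ∉ tsupport χ := by
        intro hxt
        have h1 := (norm_le_pi_norm x i).trans_lt (hR x hxt)
        rw [Real.norm_eq_abs] at h1
        rcases hx with hx | hx <;> rw [hx] at h1 <;> simp [ha, hb, abs_of_pos hR0] at h1
      have hev : (fun x => χ x • E₀) =ᶠ[nhds x] fun _ => (0 : Tensor d p) := by
        filter_upwards [notMem_tsupport_iff_eventuallyEq.mp hx'] with y hy
        simp [hy]
      funext m
      exact (hev.iteratedFDeriv ℝ m).eq_of_nhds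
    have hflux : ∀ {M} (Ψ : (Fin d → ℝ) × Jet d p M → Fin d → ℝ),
        boundaryFlux a b (fun x => Ψ (x, jet M (fun x => χ x • E₀) x)) =
          boundaryFlux a b fun x => Ψ (x, jet M (fun _ => (0 : Tensor d p)) x) :=
      fun Ψ => boundaryFlux_congr fun x i hx => by rw [hjet _ x i hx]
    have h1 : ∫ x in Set.Icc a b, ∑ c, eval x (f c) * chargeDensity G (fun x => χ x • E₀) c x =
        0 := by
      -- The flux of the zero field need not vanish pointwise, since `Φ` may depend on the position
      -- alone. Its total is zero because the zero field carries no charge.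
      refine ((h _ hE (fun x => G.electric.smul_mem _ hE₀) a b hab).trans (hflux Φ)).trans ?_
      refine (h (fun _ => 0) contDiff_const (fun _ => zero_mem _) a b hab).symm.trans ?_
      simp [chargeDensity_zero]
    have h2 := ((h' _ hE a b hab).trans (hflux Φ')).trans (h' _ contDiff_const a b hab).symm
    have h3 : ∀ x, eval x (gaussOp G 0 f) = 0 := fun x => by simpa using hgs 0 x
    simp only [chargeDensity_zero, h3, mul_zero, Finset.sum_const_zero, sub_self,
      integral_zero, hgs] at h2
    rw [integral_sub, h1, zero_sub, neg_eq_zero, integral_const_mul] at h2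
    · have h4 := (mul_eq_zero.mp h2).resolve_left (by simp)
      rw [← h4]
      refine (setIntegral_eq_integral_of_forall_compl_eq_zero fun x hx => ?_).symm
      have hx' : x ∉ tsupport χ := fun hxt => hx <| by
        have h5 := fun i => (norm_le_pi_norm x i).trans_lt (hR x hxt)
        exact ⟨fun i => (abs_lt.mp (h5 i)).1.le, fun i => (abs_lt.mp (h5 i)).2.le⟩
      rw [image_eq_zero_of_notMem_tsupport hx', zero_smul]
    · refine Continuous.integrableOn_Icc (continuous_finsetSum _ fun c _ => ?_)
      exact (contDiff_eval (f c)).continuous.mul (continuous_chargeDensity G hE c)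
    · exact Continuous.integrableOn_Icc (continuous_const.mul (hχ.continuous.mul hqc))
  -- The fundamental lemma of the calculus of variations: `q` vanishes almost everywhere, hence
  -- everywhere by continuity, hence as a polynomial.
  have hae := ae_eq_zero_of_integral_contDiff_smul_eq_zero
    (hqc.locallyIntegrable (μ := volume)) key
  have h0 : (fun x => eval x q) = fun _ => 0 :=
    (Continuous.ae_eq_iff_eq volume hqc continuous_const).mp hae
  exact MvPolynomial.funext fun x => by rw [map_zero]; exact congrFun h0 x

/-- A moment is conserved iff its weights solve the adjoint equation. -/
theorem isConserved_iff (hd : 0 < d) (f : ι → MvPolynomial (Fin d) ℝ) :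
    IsConserved G f ↔ ∀ E ∈ G.electric, gaussOp G E f = 0 :=
  ⟨gaussOp_eq_zero_of_isConserved G hd, isConserved_of_gaussOp_eq_zero G hd⟩

theorem isConserved_weight_iff (hd : 0 < d) {l : ℕ} (P : momentSpace d ι l) :
    IsConserved G (weight P) ↔ ∀ M ∈ imZ G l, momentInner P M = 0 := by
  rw [isConserved_iff G hd, orthogonal_imZ_iff]

theorem nontrivial_cokerZ_iff_hasConservedMoment (hd : 0 < d) (l : ℕ) :
    Nontrivial (cokerZ G l) ↔ HasConservedMoment G l := by
  simp only [nontrivial_cokerZ_iff, HasConservedMoment, isConserved_iff G hd]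

/-- At least one derivative acts on constant weights, so the adjoint equation is void. -/
theorem chargeConserved (hd : 0 < d) (hk : 0 < k) : ChargeConserved G := by
  intro c
  rw [isConserved_iff G hd]
  refine fun E _ => gaussOp_eq_zero_of_lt G hk E fun a => ?_
  rcases eq_or_ne a c with rfl | h
  · rw [Pi.single_eq_same]
    exact isHomogeneous_one _ _
  · rw [Pi.single_eq_of_ne h]
    exact isHomogeneous_zero _ _ _

end

/-! ### Divisibility by `|x|²` -/

/-- Comparing degree-`l` components in `f = p q` leaves only the component of `q` of degree `l - a`,
or nothing if `l < a`. -/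
theorem exists_isHomogeneous_quotient {d a l : ℕ} {p f : MvPolynomial (Fin d) ℝ}
    (hp : p.IsHomogeneous a) (hf : f.IsHomogeneous l) (h : p ∣ f) :
    f = 0 ∨ a ≤ l ∧ ∃ q : MvPolynomial (Fin d) ℝ, q.IsHomogeneous (l - a) ∧ f = p * q := by
  obtain ⟨q, rfl⟩ := h
  have h1 : p * q = ∑ i ∈ Finset.range (q.totalDegree + 1),
      if l = a + i then p * homogeneousComponent i q else 0 := by
    conv_lhs => rw [← homogeneousComponent_eq_self hf]
    conv_lhs => rw [← sum_homogeneousComponent q]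
    rw [Finset.mul_sum, map_sum]
    exact Finset.sum_congr rfl fun i _ =>
      homogeneousComponent_of_mem (hp.mul (homogeneousComponent_isHomogeneous i q))
  rcases lt_or_ge l a with hla | hla
  · left
    rw [h1]
    exact Finset.sum_eq_zero fun i _ => if_neg (by omega)
  · refine Or.inr ⟨hla, homogeneousComponent (l - a) q, homogeneousComponent_isHomogeneous _ _, ?_⟩
    rw [h1, Finset.sum_eq_single (l - a)]
    · rw [if_pos (by omega)]
    · intro i _ hi
      exact if_neg (by omega)
    · intro hi
      rw [if_pos (by omega), homogeneousComponent_eq_zero _ _ (by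
        rw [Finset.mem_range] at hi; omega), mul_zero]

theorem isHomogeneous_normSq (d : ℕ) : (normSq d).IsHomogeneous 2 :=
  IsHomogeneous.sum _ _ _ fun i _ => isHomogeneous_X_pow i 2

theorem isHomogeneous_normSq_pow (d n : ℕ) : (normSq d ^ n).IsHomogeneous (2 * n) :=
  (isHomogeneous_normSq d).pow n

theorem eval_normSq_single {d : ℕ} (i : Fin d) :
    eval (Pi.single i 1 : Fin d → ℝ) (normSq d) = 1 := by
  simp [normSq, Pi.single_apply]

theorem normSq_ne_zero {d : ℕ} (hd : 0 < d) : normSq d ≠ 0 := by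
  intro h
  have := eval_normSq_single (⟨0, hd⟩ : Fin d)
  simp [h] at this

theorem pderiv_normSq {d : ℕ} (i : Fin d) : pderiv i (normSq d) = 2 * X i := by
  simp [normSq, pderiv_X, Pi.single_apply]

/-- `X i` is prime and does not divide `|x|²`, as evaluation at another basis vector shows. This
needs `d ≥ 2`: for `d = 1`, `|x|²` is the square of the coordinate. -/
theorem normSq_dvd_of_dvd_X_mul {d : ℕ} (hd : 2 ≤ d) (i : Fin d) {g : MvPolynomial (Fin d) ℝ}
    (h : normSq d ∣ X i * g) : normSq d ∣ g := by
  obtain ⟨q, hq⟩ := h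
  have hX : Prime (X i : MvPolynomial (Fin d) ℝ) := X_prime
  have hn : ¬ (X i : MvPolynomial (Fin d) ℝ) ∣ normSq d := by
    rintro ⟨r, hr⟩
    have : Nontrivial (Fin d) := Fin.nontrivial_iff_two_le.mpr hd
    obtain ⟨j, hj⟩ := exists_ne i
    have := congrArg (eval (Pi.single j 1)) hr
    rw [eval_normSq_single, map_mul, eval_X, Pi.single_eq_of_ne hj.symm, zero_mul] at this
    exact one_ne_zero this
  obtain ⟨r, rfl⟩ := (hX.dvd_or_dvd ⟨g, hq.symm⟩).resolve_left hn
  exact ⟨r, mul_left_cancel₀ hX.ne_zero (by rw [hq]; ring)⟩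

theorem normSq_pow_dvd_pderiv {d n : ℕ} {f : MvPolynomial (Fin d) ℝ}
    (h : normSq d ^ (n + 1) ∣ f) (i : Fin d) : normSq d ^ n ∣ pderiv i f := by
  obtain ⟨g, rfl⟩ := h
  rw [pderiv_mul, pderiv_pow, Nat.add_sub_cancel]
  refine dvd_add ?_ (Dvd.dvd.mul_right (pow_dvd_pow _ (Nat.le_succ n)) _)
  exact ((Dvd.intro_left _ rfl).mul_right _).mul_right _

/-- Euler's identity gives `f = |x|^{2(n+1)} g`. In `∂_i f` the only term not visibly divisible by
`|x|^{2(n+1)}` is `2(n+1) x_i |x|^{2n} g`, so `|x|²` divides `x_i g`, hence `g`: one power more than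
the derivatives have. -/
theorem normSq_pow_dvd_of_dvd_pderiv {d n l : ℕ} (hd : 2 ≤ d) (hl : l ≠ 0)
    {f : MvPolynomial (Fin d) ℝ} (hf : f.IsHomogeneous l)
    (h : ∀ i, normSq d ^ (n + 1) ∣ pderiv i f) : normSq d ^ (n + 2) ∣ f := by
  have hl' : (l : ℝ) ≠ 0 := by exact_mod_cast hl
  have h1 : f = C (l : ℝ)⁻¹ * ∑ i, X i * pderiv i f := by
    rw [hf.sum_X_mul_pderiv, ← smul_eq_C_mul, ← Nat.cast_smul_eq_nsmul ℝ, smul_smul,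
      inv_mul_cancel₀ hl', one_smul]
  obtain ⟨g, rfl⟩ : normSq d ^ (n + 1) ∣ f := by
    rw [h1]
    exact (Finset.dvd_sum fun i _ => (h i).mul_left _).mul_left _
  let i : Fin d := ⟨0, by omega⟩
  have h2 := h i
  rw [pderiv_mul, pderiv_pow, Nat.add_sub_cancel, pderiv_normSq,
    dvd_add_left (Dvd.intro _ rfl)] at h2
  have h3 : ((n + 1 : ℕ) : MvPolynomial (Fin d) ℝ) * normSq d ^ n * (2 * X i) * g =
      normSq d ^ n * (C (((n + 1 : ℕ) : ℝ) * 2) * (X i * g)) := by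
    rw [C_mul, map_natCast, map_ofNat]
    ring
  have hn := normSq_ne_zero (d := d) (by omega)
  rw [h3, pow_succ, mul_dvd_mul_iff_left (pow_ne_zero n hn)] at h2
  have hu : IsUnit (C (((n + 1 : ℕ) : ℝ) * 2) : MvPolynomial (Fin d) ℝ) :=
    (isUnit_iff_ne_zero.mpr (by positivity)).map C
  rw [hu.dvd_mul_left] at h2
  rw [pow_succ]
  exact mul_dvd_mul_left _ (normSq_dvd_of_dvd_X_mul hd i h2)

/-! ### Harmonic polynomials -/

theorem tensorPoly_eq_zero_of_normSq_dvd {d l : ℕ} {T : Tensor d l} (hT : T ∈ tracelessSym d l)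
    (h : normSq d ∣ tensorPoly T) : tensorPoly T = 0 := by
  obtain ⟨q, hq⟩ := h
  apply fischer_self_eq_zero
  nth_rewrite 1 [hq]
  rw [fischer_normSq_mul, (mem_tracelessSym_iff hT.1).mp hT, map_zero]

theorem fischer_traceless_normSq_mul {d l : ℕ} {T : Tensor d l} (hT : T ∈ tracelessSym d l)
    (q : MvPolynomial (Fin d) ℝ) : fischer (tensorPoly T) (normSq d * q) = 0 := by
  rw [fischer_comm, fischer_normSq_mul, (mem_tracelessSym_iff hT.1).mp hT, map_zero]

/-- In degree `l`, the Fischer complement of the multiples of `|x|²` consists of harmonics: if `p`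
is orthogonal to `|x|² Δp`, then `⟨Δp, Δp⟩ = 0`. The charge index `Unit` lets the inner product on
moments serve here. -/
theorem exists_harmonic_decomposition {d l : ℕ} {f : MvPolynomial (Fin d) ℝ}
    (hf : f.IsHomogeneous l) :
    ∃ T ∈ tracelessSym d l, ∃ q, f = tensorPoly T + normSq d * q := by
  let N : Submodule ℝ (momentSpace d Unit l) :=
    ((Ideal.span {normSq d}).restrictScalars ℝ).comap
      (LinearMap.proj () ∘ₗ weightHom d Unit l)
  have hN : ∀ P, P ∈ N ↔ normSq d ∣ weight P () := fun P => Ideal.mem_span_singleton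
  obtain ⟨M, hM, P, hP, hMP⟩ := Submodule.mem_sup.mp
    ((isCompl_orthogonal_momentForm N).sup_eq_top ▸
      Submodule.mem_top (x := weightInv d Unit l (fun _ => f) fun _ => hf))
  have hPs := momentSpace_mem P ()
  -- For `l < 2` the truncated degree `l - 2` would be wrong, but then `Δp = 0`.
  have hQ : (normSq d * laplacian (weight P ())).IsHomogeneous l := by
    rcases lt_or_ge l 2 with h | h
    · have : laplacian (weight P ()) = 0 := by
        rw [laplacian_apply]
        refine Finset.sum_eq_zero fun i _ => pderiv_eq_zero_of_isHomogeneous_zero i ?_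
        have := (isHomogeneous_weight P ()).pderiv (i := i)
        rwa [show l - 1 = 0 by omega] at this
      rw [this, mul_zero]
      exact isHomogeneous_zero _ _ _
    · have := (isHomogeneous_normSq d).mul (isHomogeneous_laplacian (isHomogeneous_weight P ()))
      rwa [show 2 + (l - 2) = l by omega] at this
  have hlap : laplacian (weight P ()) = 0 := by
    apply fischer_self_eq_zero
    rw [← fischer_normSq_mul]
    have h1 := hP (weightInv d Unit l (fun _ => normSq d * laplacian (weight P ())) fun _ => hQ)
      ((hN _).mpr (by rw [weight_weightInv]; exact Dvd.intro _ rfl))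
    have h2 := sum_fischer_weight
      (weightInv d Unit l (fun _ => normSq d * laplacian (weight P ())) fun _ => hQ) P
    rw [show momentInner _ P = 0 from h1, mul_zero, weight_weightInv, Fintype.sum_unique] at h2
    exact h2
  obtain ⟨q, hq⟩ := (hN M).mp hM
  refine ⟨P.1 (), (mem_tracelessSym_iff hPs).mpr hlap, q, ?_⟩
  have h3 := congrArg (fun M => weight M ()) hMP
  simp only [weight_weightInv, weight_add] at h3
  rw [← h3, hq, add_comm]
  rfl

/-! ### Totally traceless symmetric tensor theory -/

theorem gaussOp_scalarLaw {d k : ℕ} (E : Tensor d k) (f : Unit → MvPolynomial (Fin d) ℝ) :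
    gaussOp (scalarLaw d k) E f = ∑ I, C (E I) * iterPderiv k I (f ()) := by
  rw [gaussOp, Fintype.sum_unique]
  rfl

theorem pderiv_gaussOp_scalarLaw {d k : ℕ} (E : Tensor d k) (f : MvPolynomial (Fin d) ℝ)
    (i : Fin d) :
    gaussOp (scalarLaw d k) E (fun _ => pderiv i f) =
      pderiv i (gaussOp (scalarLaw d k) E fun _ => f) := by
  simp only [gaussOp_scalarLaw, map_sum, pderiv_C_mul, iterPderiv_pderiv]

theorem gaussOp_scalarLaw_eq_zero_iff {d k : ℕ} (E : Tensor d k) {f : MvPolynomial (Fin d) ℝ}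
    (hf : f.IsHomogeneous k) :
    gaussOp (scalarLaw d k) E (fun _ => f) = 0 ↔ fischer (tensorPoly E) f = 0 := by
  have h := isHomogeneous_gaussOp (scalarLaw d k) E (fun _ : Unit => hf)
  rw [Nat.sub_self, ← totalDegree_zero_iff_isHomogeneous, totalDegree_eq_zero_iff_eq_C] at h
  rw [h, C_eq_zero, ← mul_one (tensorPoly E), fischer_tensorPoly_mul, fischer_one,
    gaussOp_scalarLaw]

/-- When `deg f = k` the operator returns a constant, the Fischer pairing of `E` with `f`; the claim
is that the multiples of `|x|²` are the orthogonal of the harmonics. -/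
theorem scalarLaw_adjoint_iff_of_degree_eq {d k : ℕ} {f : MvPolynomial (Fin d) ℝ}
    (hf : f.IsHomogeneous k) :
    (∀ E ∈ (scalarLaw d k).electric, gaussOp (scalarLaw d k) E (fun _ => f) = 0) ↔
      normSq d ∣ f := by
  simp only [gaussOp_scalarLaw_eq_zero_iff _ hf]
  constructor
  · intro h
    obtain ⟨T, hT, q, hq⟩ := exists_harmonic_decomposition hf
    have h1 := h T hT
    rw [hq, map_add, fischer_traceless_normSq_mul hT, add_zero] at h1
    rw [hq, fischer_self_eq_zero h1, zero_add]
    exact Dvd.intro _ rfl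
  · rintro ⟨q, rfl⟩ E hE
    exact fischer_traceless_normSq_mul hE q

/-- The polynomial solutions of the adjoint equation are the multiples of a power of `|x|²`. -/
theorem scalarLaw_adjoint_iff {d k l : ℕ} (hd : 2 ≤ d) {f : MvPolynomial (Fin d) ℝ}
    (hf : f.IsHomogeneous l) :
    (∀ E ∈ (scalarLaw d k).electric, gaussOp (scalarLaw d k) E (fun _ => f) = 0) ↔
      normSq d ^ (l + 1 - k) ∣ f := by
  induction l generalizing f with
  | zero =>
    rcases Nat.eq_zero_or_pos k with rfl | hk
    · simpa using scalarLaw_adjoint_iff_of_degree_eq hf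
    · rw [show 0 + 1 - k = 0 by omega, pow_zero]
      exact iff_of_true (fun E _ => gaussOp_eq_zero_of_lt _ hk E fun _ => hf) (one_dvd _)
  | succ l ih =>
    -- Below degree `k` the equation is void, and the truncated exponent is correspondingly 0. At
    -- `k` it is Fischer orthogonality; above `k`, induction through the partial derivatives
    -- applies.
    rcases lt_trichotomy (l + 1) k with h | h | h
    · rw [show l + 1 + 1 - k = 0 by omega, pow_zero]
      exact iff_of_true (fun E _ => gaussOp_eq_zero_of_lt _ h E fun _ => hf) (one_dvd _)
    · subst h
      rw [show l + 1 + 1 - (l + 1) = 1 by omega, pow_one]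
      exact scalarLaw_adjoint_iff_of_degree_eq hf
    · obtain ⟨n, hn⟩ : ∃ n, l + 1 - k = n + 1 := ⟨l - k, by omega⟩
      have hi := fun i => ih (hf.pderiv (i := i))
      rw [hn] at hi
      rw [show l + 1 + 1 - k = n + 2 by omega]
      constructor
      · refine fun hE => normSq_pow_dvd_of_dvd_pderiv hd (Nat.succ_ne_zero l) hf fun i =>
          (hi i).mp fun E hE' => ?_
        rw [pderiv_gaussOp_scalarLaw, hE E hE', map_zero]
      · intro hdvd E hE
        -- Here `l + 1 > k`, so the result has positive degree and vanishes once its derivatives do.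
        refine eq_zero_of_forall_pderiv_eq_zero (l := l + 1 - k) (by omega)
          (isHomogeneous_gaussOp _ E fun _ => hf) fun i => ?_
        rw [← pderiv_gaussOp_scalarLaw]
        exact (hi i).mpr (normSq_pow_dvd_pderiv hdvd i) E hE

theorem scalarLaw_isConserved_iff {d k l : ℕ} (hd : 2 ≤ d) {f : MvPolynomial (Fin d) ℝ}
    (hf : f.IsHomogeneous l) :
    IsConserved (scalarLaw d k) (fun _ => f) ↔ normSq d ^ (l + 1 - k) ∣ f := by
  rw [isConserved_iff _ (by omega), scalarLaw_adjoint_iff hd hf]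

theorem scalarLaw_isConserved_iff_mem_span {d k l : ℕ} (hd : 2 ≤ d) {f : MvPolynomial (Fin d) ℝ}
    (hf : f.IsHomogeneous l) :
    IsConserved (scalarLaw d k) (fun _ => f) ↔
      f ∈ Submodule.span ℝ {q | ∃ n : ℕ, l + 1 ≤ n + k ∧ n ≤ l / 2 ∧
        ∃ J : Fin (l - 2 * n) → Fin d, q = normSq d ^ n * ∏ s, X (J s)} := by
  rw [scalarLaw_isConserved_iff hd hf]
  constructor
  · intro h
    rcases exists_isHomogeneous_quotient (isHomogeneous_normSq_pow d _) hf h with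
      rfl | ⟨hl, q, hq, rfl⟩
    · exact zero_mem _
    · obtain ⟨T, rfl⟩ := exists_tensorPoly_eq hq
      rw [tensorPoly_apply, Finset.mul_sum]
      refine Submodule.sum_mem _ fun J _ => ?_
      rw [← smul_eq_C_mul, mul_smul_comm]
      -- The smallest admissible power `n = l + 1 - k` already spans.
      exact Submodule.smul_mem _ _ (Submodule.subset_span ⟨_, by omega, by omega, J, rfl⟩)
  · intro h
    rw [← Ideal.mem_span_singleton]
    refine (Submodule.span_le (p := (Ideal.span {_}).restrictScalars ℝ)).mpr ?_ h
    rintro _ ⟨n, hn, _, J, rfl⟩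
    exact Ideal.mem_span_singleton.mpr ((pow_dvd_pow _ (by omega)).mul_right _)

/-- A nonzero multiple of `|x|^{2(l+1-k)}` of degree `l` exists exactly when `2(l+1-k) ≤ l`; a power
of one coordinate fills up the degree. -/
theorem scalarLaw_hasConservedMoment_iff {d k : ℕ} (hd : 2 ≤ d) (hk : 1 ≤ k) (l : ℕ) :
    HasConservedMoment (scalarLaw d k) l ↔ l ≤ 2 * k - 2 := by
  constructor
  · rintro ⟨f, hf, hf0, hfc⟩
    have h := (scalarLaw_isConserved_iff hd (hf ())).mp hfc
    rcases exists_isHomogeneous_quotient (isHomogeneous_normSq_pow d _) (hf ()) h with h0 | h0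
    · exact absurd (funext fun _ => h0) hf0
    · omega
  · intro h
    let i : Fin d := ⟨0, by omega⟩
    have hf : (normSq d ^ (l + 1 - k) * X i ^ (l - 2 * (l + 1 - k))).IsHomogeneous l := by
      have := (isHomogeneous_normSq_pow d (l + 1 - k)).mul
        (isHomogeneous_X_pow (R := ℝ) i (l - 2 * (l + 1 - k)))
      rwa [show 2 * (l + 1 - k) + (l - 2 * (l + 1 - k)) = l by omega] at this
    refine ⟨fun _ => _, fun _ => hf, fun h0 => ?_,
      (scalarLaw_isConserved_iff hd hf).mpr (Dvd.intro _ rfl)⟩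
    exact mul_ne_zero (pow_ne_zero _ (normSq_ne_zero (by omega))) (pow_ne_zero _ (X_ne_zero i))
      (congrFun h0 ())

/-- The polynomial `∑ n, |x|^{2n} h_n` for traceless symmetric tensors `h_n` of rank `l - 2n`. -/
def harmonicSum (d k l : ℕ) :
    ((n : Finset.Icc (l + 1 - k) (l / 2)) → tracelessSym d (l - 2 * n.1)) →ₗ[ℝ]
      MvPolynomial (Fin d) ℝ :=
  ∑ n : Finset.Icc (l + 1 - k) (l / 2), LinearMap.mulLeft ℝ (normSq d ^ n.1) ∘ₗ tensorPoly ∘ₗ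
    (tracelessSym d (l - 2 * n.1)).subtype ∘ₗ LinearMap.proj n

theorem harmonicSum_apply {d k l : ℕ}
    (w : (n : Finset.Icc (l + 1 - k) (l / 2)) → tracelessSym d (l - 2 * n.1)) :
    harmonicSum d k l w = ∑ n, normSq d ^ n.1 * tensorPoly (w n).1 := by
  simp [harmonicSum]

theorem isHomogeneous_harmonicSum {d k l : ℕ}
    (w : (n : Finset.Icc (l + 1 - k) (l / 2)) → tracelessSym d (l - 2 * n.1)) :
    (harmonicSum d k l w).IsHomogeneous l := by
  rw [harmonicSum_apply]
  refine IsHomogeneous.sum _ _ _ fun n _ => ?_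
  have := (isHomogeneous_normSq_pow d n.1).mul (isHomogeneous_tensorPoly (w n).1)
  have hn := (Finset.mem_Icc.mp n.2).2
  rwa [show 2 * n.1 + (l - 2 * n.1) = l by omega] at this

/-- In a vanishing sum, all terms above the lowest index `n` are divisible by `|x|^{2(n+1)}`. Hence
`|x|²` divides the harmonic `h_n`, which is Fischer-orthogonal to its own multiple and so vanishes.
-/
theorem harmonicSum_injective {d : ℕ} (hd : 0 < d) (k l : ℕ) :
    Function.Injective (harmonicSum d k l) := by
  rw [← LinearMap.ker_eq_bot, LinearMap.ker_eq_bot']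
  intro w hw
  have key : ∀ N, ∀ n : Finset.Icc (l + 1 - k) (l / 2), n.1 = N → w n = 0 := by
    intro N
    induction N using Nat.strong_induction_on with
    | _ N ih =>
      rintro n rfl
      rw [harmonicSum_apply, ← Finset.add_sum_erase _ _ (Finset.mem_univ n)] at hw
      have h1 : normSq d ^ (n.1 + 1) ∣
          ∑ m ∈ Finset.univ.erase n, normSq d ^ m.1 * tensorPoly (w m).1 := by
        refine Finset.dvd_sum fun m hm => ?_
        rcases lt_or_ge m.1 n.1 with h | h
        · rw [ih m.1 h m rfl, Submodule.coe_zero, map_zero, mul_zero]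
          exact dvd_zero _
        · have hne : m.1 ≠ n.1 := fun h => Finset.ne_of_mem_erase hm (Subtype.ext h)
          exact (pow_dvd_pow _ (by omega)).mul_right _
      rw [eq_neg_of_add_eq_zero_right hw, dvd_neg, pow_succ,
        mul_dvd_mul_iff_left (pow_ne_zero _ (normSq_ne_zero hd))] at h1
      have h2 := tensorPoly_eq_zero_of_normSq_dvd (w n).2 h1
      exact Subtype.ext (tensorPoly_injOn (w n).2.1 (zero_mem _) (h2.trans (map_zero _).symm))
  funext n
  exact key n.1 n rfl

/-- Splitting off the harmonic part of `q` leaves `|x|²` times a polynomial of degree `r - 2`; the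
factor `|x|²` is absorbed by passing to `n + 1`. -/
theorem normSq_pow_mul_mem_range_harmonicSum {d k l : ℕ} (r : ℕ) :
    ∀ n, l + 1 - k ≤ n → 2 * n + r = l → ∀ q : MvPolynomial (Fin d) ℝ, q.IsHomogeneous r →
      normSq d ^ n * q ∈ LinearMap.range (harmonicSum d k l) := by
  induction r using Nat.strong_induction_on with
  | _ r ih =>
    intro n hn hr q hq
    obtain ⟨T, hT, q', rfl⟩ := exists_harmonic_decomposition hq
    rw [mul_add]
    refine add_mem ?_ ?_
    · obtain rfl : r = l - 2 * n := by omega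
      refine ⟨Pi.single ⟨n, Finset.mem_Icc.mpr ⟨hn, by omega⟩⟩ ⟨T, hT⟩, ?_⟩
      rw [harmonicSum_apply, Finset.sum_eq_single ⟨n, Finset.mem_Icc.mpr ⟨hn, by omega⟩⟩]
      · rw [Pi.single_eq_same]
      · intro m _ hm
        rw [Pi.single_eq_of_ne hm, Submodule.coe_zero, map_zero, mul_zero]
      · simp
    · have h1 : (normSq d * q').IsHomogeneous r := by
        have := hq.sub (isHomogeneous_tensorPoly T)
        rwa [add_sub_cancel_left] at this
      rcases exists_isHomogeneous_quotient (isHomogeneous_normSq d) h1 (Dvd.intro _ rfl) with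
        h0 | ⟨h2, q'', hq'', h0⟩
      · rw [h0, mul_zero]
        exact zero_mem _
      · rw [h0, ← mul_assoc, ← pow_succ]
        exact ih (r - 2) (by omega) (n + 1) (by omega) (by omega) q'' hq''

theorem harmonicSum_rotate {d k l : ℕ} (g : SO d)
    (w : (n : Finset.Icc (l + 1 - k) (l / 2)) → tracelessSym d (l - 2 * n.1)) :
    harmonicSum d k l (fun n => ⟨rotate g.1 (w n).1, rotate_mem_tracelessSym g (w n).2⟩) =
      rotatePoly g.1 (harmonicSum d k l w) := by
  simp only [harmonicSum_apply, map_sum, map_mul, map_pow, rotatePoly_normSq, tensorPoly_rotate]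

theorem scalarLaw_exists_cokerZ_equiv {d : ℕ} (hd : 2 ≤ d) (k l : ℕ) :
    ∃ e : cokerZ (scalarLaw d k) l ≃ₗ[ℝ]
        ((n : Finset.Icc (l + 1 - k) (l / 2)) → tracelessSym d (l - 2 * n.1)),
      ∀ (g : SO d) (M : momentSpace d Unit l) (n : Finset.Icc (l + 1 - k) (l / 2)),
        (e (Submodule.Quotient.mk (momentRotate (scalarLaw d k) l g M)) n).1 =
          rotate g.1 (e (Submodule.Quotient.mk M) n).1 := by
  obtain ⟨e, he⟩ := exists_cokerZ_equiv (scalarLaw d k) (l := l)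
    (LinearMap.pi fun _ => harmonicSum d k l)
    (fun v w h => harmonicSum_injective (by omega) k l (congrFun h ()))
    (fun w _ => isHomogeneous_harmonicSum w)
    (fun f hf => by
      refine (scalarLaw_adjoint_iff hd (hf ())).trans ⟨fun h => ?_, ?_⟩
      · rcases exists_isHomogeneous_quotient (isHomogeneous_normSq_pow d _) (hf ()) h with
          h0 | ⟨hl, q, hq, h0⟩
        · exact ⟨0, by rw [map_zero]; exact funext fun _ => h0.symm⟩
        · obtain ⟨w, hw⟩ := normSq_pow_mul_mem_range_harmonicSum (k := k) _ _ le_rfl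
            (show 2 * (l + 1 - k) + (l - 2 * (l + 1 - k)) = l by omega) q hq
          exact ⟨w, funext fun _ => hw.trans h0.symm⟩
      · rintro ⟨w, rfl⟩
        rw [LinearMap.pi_apply, harmonicSum_apply]
        exact Finset.dvd_sum fun n _ =>
          (pow_dvd_pow _ (Finset.mem_Icc.mp n.2).1).mul_right _)
  refine ⟨e, fun g M n => ?_⟩
  rw [he g (fun w n => ⟨rotate g.1 (w n).1, rotate_mem_tracelessSym g (w n).2⟩)]
  intro w a
  rw [LinearMap.pi_apply, harmonicSum_rotate, Fintype.sum_unique]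
  simp [scalarLaw]

theorem scalarLaw_isNonFractonic {d : ℕ} (hd : 2 ≤ d) : IsNonFractonic (scalarLaw d 1) := by
  refine ⟨chargeConserved _ (by omega) one_pos, fun l hl h => ?_⟩
  rw [scalarLaw_hasConservedMoment_iff hd le_rfl] at h
  omega

theorem scalarLaw_isFractonic {d k : ℕ} (hd : 2 ≤ d) (hk : 2 ≤ k) :
    IsFractonic (scalarLaw d k) := by
  refine ⟨chargeConserved _ (by omega) (by omega), ?_, 1, le_rfl, ?_⟩
  · refine (Set.finite_Iic (2 * k - 2)).subset fun l hl => ?_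
    exact (scalarLaw_hasConservedMoment_iff hd (by omega) l).mp hl.2
  · rw [scalarLaw_hasConservedMoment_iff hd (by omega)]
    omega

theorem scalarLaw_not_isHyperFractonic {d k : ℕ} (hd : 2 ≤ d) (hk : 1 ≤ k) :
    ¬ IsHyperFractonic (scalarLaw d k) := by
  refine Set.not_infinite.mpr ((Set.finite_Iic (2 * k - 2)).subset fun l hl => ?_)
  exact (scalarLaw_hasConservedMoment_iff hd hk l).mp hl.2

/-! ### Symmetric traceless tensor with a vector charge: the conformal Killing equation -/

theorem gaussOp_vectorLaw {d : ℕ} (E : Tensor d 2) (f : Fin d → MvPolynomial (Fin d) ℝ) :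
    gaussOp (vectorLaw d) E f = ∑ c, ∑ i, C (E ![i, c]) * pderiv i (f c) := by
  refine Finset.sum_congr rfl fun c _ => ?_
  rw [← (Equiv.funUnique (Fin 1) (Fin d)).symm.sum_comp]
  rfl

theorem matrixTensor_mem_tracelessSym {d : ℕ} {A : Matrix (Fin d) (Fin d) ℝ}
    (hA : ∀ i j, A i j = A j i) (htr : ∑ i, A i i = 0) :
    (fun K => A (K 0) (K 1) : Tensor d 2) ∈ tracelessSym d 2 := by
  refine ⟨fun σ J => ?_, fun s t hst J => ?_⟩
  · have hσ : (σ 0 = 0 ∧ σ 1 = 1) ∨ (σ 0 = 1 ∧ σ 1 = 0) := by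
      revert σ
      decide
    rcases hσ with ⟨h0, h1⟩ | ⟨h0, h1⟩
    · simp [h0, h1]
    · simp [h0, h1, hA (J 1)]
  · have hst' : (s = 0 ∧ t = 1) ∨ (s = 1 ∧ t = 0) := by
      revert s t
      decide
    rcases hst' with ⟨rfl, rfl⟩ | ⟨rfl, rfl⟩ <;> simpa using htr

theorem tracelessSym_two_symm {d : ℕ} {E : Tensor d 2} (hE : E ∈ tracelessSym d 2)
    (i j : Fin d) : E ![i, j] = E ![j, i] := by
  rw [← hE.1 (Equiv.swap 0 1) ![i, j]]
  congr 1
  funext s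
  fin_cases s <;> simp

theorem tracelessSym_two_trace {d : ℕ} {E : Tensor d 2} (hE : E ∈ tracelessSym d 2) :
    ∑ i, E ![i, i] = 0 := by
  rcases isEmpty_or_nonempty (Fin d) with h | ⟨⟨c⟩⟩
  · simp
  rw [← hE.2 0 1 (by simp) ![c, c]]
  refine Finset.sum_congr rfl fun i _ => congrArg E ?_
  funext s
  fin_cases s <;> simp

/-- The conformal Killing equation `∂_i f_j + ∂_j f_i = 2 δ_{ij} σ`. -/
def ConformalKilling {d : ℕ} (f : Fin d → MvPolynomial (Fin d) ℝ) (σ : MvPolynomial (Fin d) ℝ) :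
    Prop :=
  ∀ i j, pderiv i (f j) + pderiv j (f i) = if i = j then 2 * σ else 0

/-- A matrix orthogonal to all symmetric traceless ones has a symmetric part that is a multiple of
the identity; apply this to `∂_i f_j`. The test matrices are `e_ii - e_{i₀i₀}` for the diagonal and
`e_ij + e_ji` off it. -/
theorem vectorLaw_adjoint_iff {d : ℕ} (hd : 0 < d) (f : Fin d → MvPolynomial (Fin d) ℝ) :
    (∀ E ∈ (vectorLaw d).electric, gaussOp (vectorLaw d) E f = 0) ↔
      ∃ σ, ConformalKilling f σ := by
  rw [show (vectorLaw d).electric = tracelessSym d 2 from rfl]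
  simp only [gaussOp_vectorLaw]
  constructor
  · intro h
    have hA : ∀ A : Matrix (Fin d) (Fin d) ℝ, (∀ i j, A i j = A j i) → ∑ i, A i i = 0 →
        ∑ c, ∑ i, C (A i c) * pderiv i (f c) = 0 := fun A hA htr => by
      have h1 := h (fun K => A (K 0) (K 1)) (matrixTensor_mem_tracelessSym hA htr)
      simpa only [Matrix.cons_val_zero, Matrix.cons_val_one] using h1
    let i₀ : Fin d := ⟨0, hd⟩
    have hdiag : ∀ i, pderiv i (f i) = pderiv i₀ (f i₀) := by
      intro i
      have h1 := hA (fun a b => (if a = i ∧ b = i then 1 else 0) -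
        if a = i₀ ∧ b = i₀ then 1 else 0) (fun a b => by simp only [and_comm])
        (by simp [Finset.sum_sub_distrib])
      simp only [ite_and, map_sub, sub_mul, Finset.sum_sub_distrib, apply_ite C, map_one, map_zero,
        ite_mul, one_mul, zero_mul, Finset.sum_ite_eq', Finset.mem_univ, if_true] at h1
      exact sub_eq_zero.mp h1
    refine ⟨pderiv i₀ (f i₀), fun i j => ?_⟩
    split_ifs with hij
    · subst hij
      rw [hdiag, two_mul]
    · have h1 := hA (fun a b => (if a = i ∧ b = j then 1 else 0) +
        if a = j ∧ b = i then 1 else 0) (fun a b => by rw [add_comm]; simp only [and_comm])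
        (by
          refine Finset.sum_eq_zero fun a _ => ?_
          rw [if_neg (by rintro ⟨rfl, h⟩; exact hij h),
            if_neg (by rintro ⟨rfl, h⟩; exact hij h.symm), add_zero])
      simpa only [ite_and, map_add, add_mul, Finset.sum_add_distrib, apply_ite C, map_one,
        map_zero, ite_mul, one_mul, zero_mul, Finset.sum_ite_eq', Finset.mem_univ, if_true] using h1
  · rintro ⟨σ, hσ⟩ E hE
    have h1 : ∑ c, ∑ i, C (E ![i, c]) * pderiv i (f c) =
        ∑ c, ∑ i, C (E ![i, c]) * pderiv c (f i) := by
      rw [Finset.sum_comm]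
      exact Finset.sum_congr rfl fun c _ => Finset.sum_congr rfl fun i _ => by
        rw [tracelessSym_two_symm hE]
    have h2 : (2 : MvPolynomial (Fin d) ℝ) * ∑ c, ∑ i, C (E ![i, c]) * pderiv i (f c) = 0 := by
      rw [two_mul]
      nth_rewrite 2 [h1]
      simp only [← Finset.sum_add_distrib, ← mul_add, hσ _ _, mul_ite, mul_zero,
        Finset.sum_ite_eq', Finset.mem_univ, if_true, ← Finset.sum_mul, ← map_sum,
        tracelessSym_two_trace hE, map_zero, zero_mul]
    exact (mul_eq_zero.mp h2).resolve_left two_ne_zero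

theorem pderiv_two_mul {d : ℕ} (i : Fin d) (f : MvPolynomial (Fin d) ℝ) :
    pderiv i (2 * f) = 2 * pderiv i f := by
  rw [two_mul, map_add, two_mul]

/-- As for the Christoffel symbols: differentiate the equation, add two of the three cyclic versions
and subtract the third. -/
theorem ConformalKilling.pderiv_pderiv {d : ℕ} {f : Fin d → MvPolynomial (Fin d) ℝ}
    {σ : MvPolynomial (Fin d) ℝ} (h : ConformalKilling f σ) (i j k : Fin d) :
    pderiv i (pderiv j (f k)) = (if j = k then pderiv i σ else 0) +
      (if i = k then pderiv j σ else 0) - if i = j then pderiv k σ else 0 := by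
  have key : ∀ a b c, pderiv a (pderiv b (f c)) + pderiv a (pderiv c (f b)) =
      2 * if b = c then pderiv a σ else 0 := by
    intro a b c
    rw [← map_add, h b c, apply_ite (pderiv a), map_zero, pderiv_two_mul, mul_ite, mul_zero]
  have h1 := key i j k
  have h2 := key j i k
  have h3 := key k i j
  rw [pderiv_comm j i] at h2
  rw [pderiv_comm k i, pderiv_comm k j] at h3
  have h4 : (2 : MvPolynomial (Fin d) ℝ) * pderiv i (pderiv j (f k)) =
      2 * ((if j = k then pderiv i σ else 0) +
      (if i = k then pderiv j σ else 0) - if i = j then pderiv k σ else 0) := by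
    linear_combination h1 + h2 - h3
  exact mul_left_cancel₀ two_ne_zero h4

theorem exists_ne_ne {d : ℕ} (hd : 3 ≤ d) (j m : Fin d) : ∃ i, i ≠ j ∧ i ≠ m := by
  by_contra! h
  have h1 : (Finset.univ : Finset (Fin d)) ⊆ {j, m} := fun i _ => by
    by_cases hi : i = j
    · simp [hi]
    · simp [h i hi]
  have h2 := (Finset.card_le_card h1).trans Finset.card_le_two
  rw [Finset.card_univ, Fintype.card_fin] at h2
  omega

/-- Commuting `∂_m` with `∂_i ∂_j f_i`, for `i` distinct from `j` and `m`, gives `∂_m ∂_j σ =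
-δ_{mj} ∂_i² σ`. Off the diagonal this is zero. On it, any two of `∂_m²σ`, `∂_i²σ`, `∂_k²σ` at three
distinct indices are opposite, so all vanish; this is where `d ≥ 3` enters. -/
theorem ConformalKilling.pderiv_pderiv_factor {d : ℕ} (hd : 3 ≤ d)
    {f : Fin d → MvPolynomial (Fin d) ℝ} {σ : MvPolynomial (Fin d) ℝ} (h : ConformalKilling f σ)
    (m j : Fin d) : pderiv m (pderiv j σ) = 0 := by
  have key : ∀ i j m : Fin d, i ≠ j → i ≠ m →
      pderiv m (pderiv j σ) = if m = j then - pderiv i (pderiv i σ) else 0 := by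
    intro i j m hij him
    have h1 := pderiv_comm m i (pderiv j (f i))
    rw [h.pderiv_pderiv i j i, h.pderiv_pderiv m j i] at h1
    simp only [hij.symm, hij, him.symm, if_true, if_false, zero_add, sub_zero, zero_sub] at h1
    rw [h1]
    split_ifs <;> simp
  rcases eq_or_ne m j with rfl | hmj
  · obtain ⟨i, hi, -⟩ := exists_ne_ne hd m m
    obtain ⟨k, hk, hki⟩ := exists_ne_ne hd m i
    have h1 := key i m m hi hi
    have h2 := key k m m hk hk
    have h3 := key k i i hki hki
    rw [if_pos rfl] at h1 h2 h3
    have h4 : (2 : MvPolynomial (Fin d) ℝ) * pderiv m (pderiv m σ) = 0 := by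
      linear_combination h1 + h2 - h3
    exact (mul_eq_zero.mp h4).resolve_left two_ne_zero
  · obtain ⟨i, hi, hi'⟩ := exists_ne_ne hd j m
    rw [key i j m hi hi', if_neg hmj]

theorem ConformalKilling.isHomogeneous_factor {d l : ℕ} (hd : 0 < d)
    {f : Fin d → MvPolynomial (Fin d) ℝ} (hf : ∀ a, (f a).IsHomogeneous l)
    {σ : MvPolynomial (Fin d) ℝ} (h : ConformalKilling f σ) : σ.IsHomogeneous (l - 1) := by
  have h1 := h ⟨0, hd⟩ ⟨0, hd⟩
  rw [if_pos rfl, ← two_mul] at h1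
  rw [← mul_left_cancel₀ two_ne_zero h1]
  exact (hf _).pderiv

/-- For `l ≥ 3`, `∂_j σ` has positive degree `l - 2` and vanishing derivatives, so it is zero. All
second derivatives of `f` are linear in `∂σ`, hence zero too, and Euler's identity is applied twice.
-/
theorem ConformalKilling.eq_zero {d l : ℕ} (hd : 3 ≤ d) (hl : 3 ≤ l)
    {f : Fin d → MvPolynomial (Fin d) ℝ} (hf : ∀ a, (f a).IsHomogeneous l)
    {σ : MvPolynomial (Fin d) ℝ} (h : ConformalKilling f σ) : f = 0 := by
  have hσ := h.isHomogeneous_factor (by omega) hf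
  have h1 : ∀ j, pderiv j σ = 0 := fun j =>
    eq_zero_of_forall_pderiv_eq_zero (by omega) hσ.pderiv fun m => h.pderiv_pderiv_factor hd m j
  funext k
  refine eq_zero_of_forall_pderiv_eq_zero (by omega) (hf k) fun j => ?_
  refine eq_zero_of_forall_pderiv_eq_zero (l := l - 1) (by omega) (hf k).pderiv fun i => ?_
  rw [h.pderiv_pderiv]
  simp [h1]

theorem eq_C_of_isHomogeneous_zero {d : ℕ} {f : MvPolynomial (Fin d) ℝ}
    (hf : f.IsHomogeneous 0) : f = C (coeff 0 f) := by
  rwa [← totalDegree_zero_iff_isHomogeneous, totalDegree_eq_zero_iff_eq_C] at hf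

/-! ### The conformal Killing fields -/

/-- The constant fields. -/
def translationField (d : ℕ) : Tensor d 1 →ₗ[ℝ] Fin d → MvPolynomial (Fin d) ℝ where
  toFun v a := C (v fun _ => a)
  map_add' v w := by
    funext a
    simp
  map_smul' c v := by
    funext a
    simp [smul_eq_C_mul]

/-- The linear combinations of a dilation and rotations. -/
def linearField (d : ℕ) :
    Tensor d 0 × antisymTensor d →ₗ[ℝ] Fin d → MvPolynomial (Fin d) ℝ where
  toFun w a := C (w.1 Fin.elim0) * X a + ∑ i, C (w.2.1 ![i, a]) * X i
  map_add' v w := by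
    funext a
    simp only [Prod.fst_add, Prod.snd_add, Submodule.coe_add, Pi.add_apply, C_add, add_mul,
      Finset.sum_add_distrib]
    ring
  map_smul' c v := by
    funext a
    simp [smul_eq_C_mul, Finset.mul_sum, mul_assoc]

/-- The special conformal transformations. -/
def specialField (d : ℕ) : Tensor d 1 →ₗ[ℝ] Fin d → MvPolynomial (Fin d) ℝ where
  toFun v a := C (v fun _ => a) * normSq d - 2 * X a * ∑ i, C (v fun _ => i) * X i
  map_add' v w := by
    funext a
    simp only [Pi.add_apply, C_add, add_mul, Finset.sum_add_distrib]
    ring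
  map_smul' c v := by
    funext a
    simp only [Pi.smul_apply, smul_eq_mul, C_mul, smul_eq_C_mul, RingHom.id_apply, mul_assoc,
      ← Finset.mul_sum]
    ring

theorem translationField_apply {d : ℕ} (v : Tensor d 1) (a : Fin d) :
    translationField d v a = C (v fun _ => a) := rfl

theorem linearField_apply {d : ℕ} (w : Tensor d 0 × antisymTensor d) (a : Fin d) :
    linearField d w a = C (w.1 Fin.elim0) * X a + ∑ i, C (w.2.1 ![i, a]) * X i := rfl

theorem specialField_apply {d : ℕ} (v : Tensor d 1) (a : Fin d) :
    specialField d v a = C (v fun _ => a) * normSq d - 2 * X a * ∑ i, C (v fun _ => i) * X i :=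
  rfl

theorem isHomogeneous_sum_C_mul_X {d : ℕ} (c : Fin d → ℝ) :
    (∑ i, C (c i) * X i : MvPolynomial (Fin d) ℝ).IsHomogeneous 1 :=
  IsHomogeneous.sum _ _ _ fun i _ => isHomogeneous_C_mul_X _ i

theorem pderiv_sum_C_mul_X {d : ℕ} (c : Fin d → ℝ) (j : Fin d) :
    pderiv j (∑ i, C (c i) * X i : MvPolynomial (Fin d) ℝ) = C (c j) := by
  simp [pderiv_X, Pi.single_apply]

theorem isHomogeneous_translationField {d : ℕ} (v : Tensor d 1) (a : Fin d) :
    (translationField d v a).IsHomogeneous 0 := isHomogeneous_C _ _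

theorem isHomogeneous_linearField {d : ℕ} (w : Tensor d 0 × antisymTensor d) (a : Fin d) :
    (linearField d w a).IsHomogeneous 1 :=
  (isHomogeneous_C_mul_X _ a).add (isHomogeneous_sum_C_mul_X _)

theorem isHomogeneous_specialField {d : ℕ} (v : Tensor d 1) (a : Fin d) :
    (specialField d v a).IsHomogeneous 2 := by
  refine ((isHomogeneous_normSq d).C_mul _).sub ?_
  exact (((isHomogeneous_X ℝ a).C_mul 2).mul (isHomogeneous_sum_C_mul_X _) :)

theorem vector_ext {d : ℕ} {v w : Tensor d 1} (h : ∀ a, v (fun _ => a) = w fun _ => a) :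
    v = w := by
  funext K
  have hK : K = fun _ => K 0 := funext fun s => congrArg K (Subsingleton.elim s 0)
  rw [hK]
  exact h _

theorem translationField_injective (d : ℕ) : Function.Injective (translationField d) :=
  fun _ _ h => vector_ext fun a => C_injective _ _ (congrFun h a)

theorem pderiv_linearField {d : ℕ} (w : Tensor d 0 × antisymTensor d) (i a : Fin d) :
    pderiv i (linearField d w a) =
      C ((if i = a then w.1 Fin.elim0 else 0) + w.2.1 ![i, a]) := by
  rw [linearField_apply, map_add, pderiv_sum_C_mul_X, pderiv_C_mul, pderiv_X, C_add]
  by_cases h : i = a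
  · simp [h]
  · simp [h]

theorem antisymTensor_swap {d : ℕ} (A : antisymTensor d) (i j : Fin d) :
    A.1 ![i, j] = - A.1 ![j, i] := by
  have h : ![i, j] = ![j, i] ∘ Equiv.swap (0 : Fin 2) 1 := by
    funext s
    fin_cases s <;> simp
  rw [h, A.2]

theorem antisymTensor_self {d : ℕ} (A : antisymTensor d) (i : Fin d) : A.1 ![i, i] = 0 := by
  have := antisymTensor_swap A i i
  linarith

theorem pair_eta {d : ℕ} (K : Fin 2 → Fin d) : ![K 0, K 1] = K := by
  funext s
  fin_cases s <;> rfl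

theorem linearField_injective {d : ℕ} (hd : 0 < d) : Function.Injective (linearField d) := by
  rw [← LinearMap.ker_eq_bot, LinearMap.ker_eq_bot']
  intro w hw
  have h : ∀ i a, (if i = a then w.1 Fin.elim0 else 0) + w.2.1 ![i, a] = 0 := by
    intro i a
    have h1 := pderiv_linearField w i a
    rw [hw, Pi.zero_apply, map_zero] at h1
    exact C_eq_zero.mp h1.symm
  have h0 : w.1 Fin.elim0 = 0 := by
    have := h ⟨0, hd⟩ ⟨0, hd⟩
    rwa [if_pos rfl, antisymTensor_self, add_zero] at this
  refine Prod.ext (funext fun K => ?_) (Subtype.ext (funext fun K => ?_))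
  · rw [Subsingleton.elim K Fin.elim0]
    exact h0
  · have := h (K 0) (K 1)
    rw [pair_eta, h0, ite_self, zero_add] at this
    exact this

theorem pderiv_specialField {d : ℕ} (v : Tensor d 1) (i a : Fin d) :
    pderiv i (specialField d v a) = 2 * (C (v fun _ => a) * X i - C (v fun _ => i) * X a) -
      if i = a then 2 * ∑ j, C (v fun _ => j) * X j else 0 := by
  rw [specialField_apply, map_sub, pderiv_C_mul, pderiv_normSq, pderiv_mul, pderiv_sum_C_mul_X,
    pderiv_two_mul, pderiv_X]
  by_cases h : i = a
  · subst h
    simp only [Pi.single_eq_same, if_true]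
    ring
  · simp only [h, Pi.single_eq_of_ne (Ne.symm h), if_false]
    ring

theorem pderiv_pderiv_specialField {d : ℕ} (v : Tensor d 1) {i a : Fin d} (h : i ≠ a) :
    pderiv i (pderiv i (specialField d v a)) = C (2 * v fun _ => a) := by
  rw [pderiv_specialField, if_neg h, sub_zero, pderiv_two_mul, map_sub, pderiv_C_mul, pderiv_C_mul,
    pderiv_X_self, pderiv_X_of_ne h.symm, C_mul, map_ofNat]
  ring

/-- A second derivative of the component `a` along a direction `i ≠ a` isolates `2 v_a`. -/
theorem specialField_injective {d : ℕ} (hd : 3 ≤ d) : Function.Injective (specialField d) := by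
  intro v w h
  refine vector_ext fun a => ?_
  obtain ⟨i, hi, -⟩ := exists_ne_ne hd a a
  have h1 := pderiv_pderiv_specialField v hi
  rw [h, pderiv_pderiv_specialField w hi] at h1
  exact (mul_left_cancel₀ two_ne_zero (C_injective _ _ h1)).symm

theorem translationField_surjective {d : ℕ} {f : Fin d → MvPolynomial (Fin d) ℝ}
    (hf : ∀ a, (f a).IsHomogeneous 0) : ∃ v, translationField d v = f :=
  ⟨fun K => coeff 0 (f (K 0)), funext fun a => (eq_C_of_isHomogeneous_zero (hf a)).symm⟩

theorem conformalKilling_linearField {d : ℕ} (w : Tensor d 0 × antisymTensor d) :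
    ConformalKilling (linearField d w) (C (w.1 Fin.elim0)) := by
  intro i j
  rw [pderiv_linearField, pderiv_linearField, antisymTensor_swap w.2 i j, ← C_add]
  by_cases h : i = j
  · subst h
    simp only [if_true, C_add, C_neg]
    ring
  · simp [h, Ne.symm h]

theorem conformalKilling_specialField {d : ℕ} (v : Tensor d 1) :
    ConformalKilling (specialField d v) (-2 * ∑ j, C (v fun _ => j) * X j) := by
  intro i j
  rw [pderiv_specialField, pderiv_specialField]
  by_cases h : i = j
  · subst h
    simp only [if_true]
    ring
  · simp only [h, Ne.symm h, if_false]
    ring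

theorem ConformalKilling.exists_linearField {d : ℕ}
    {f : Fin d → MvPolynomial (Fin d) ℝ} (hf : ∀ a, (f a).IsHomogeneous 1)
    {σ : MvPolynomial (Fin d) ℝ} (hσ : σ.IsHomogeneous 0) (h : ConformalKilling f σ) :
    ∃ w, linearField d w = f := by
  set m : Fin d → Fin d → ℝ := fun i j => coeff 0 (pderiv i (f j)) with hm
  have hfm : ∀ i j, pderiv i (f j) = C (m i j) := fun i j =>
    eq_C_of_isHomogeneous_zero (hf j).pderiv
  have hs := eq_C_of_isHomogeneous_zero hσ
  set s := coeff 0 σ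
  have hms : ∀ i j, m i j + m j i = if i = j then 2 * s else 0 := by
    intro i j
    have h1 := h i j
    rw [hfm, hfm, hs, ← C_add] at h1
    apply C_injective (Fin d)
    rw [h1, apply_ite C, C_mul, map_ofNat, map_zero]
  -- The constant Jacobian splits into its scalar part `s`, the dilation, and the remainder `m -
  -- s·1`, which the Killing equation makes antisymmetric.
  refine ⟨(fun _ => s, ⟨fun K => m (K 0) (K 1) - s * (1 : Matrix (Fin d) (Fin d) ℝ) (K 0) (K 1),
    fun J => ?_⟩), ?_⟩
  · have h1 := hms (J 0) (J 1)
    simp only [Function.comp_apply, Equiv.swap_apply_left, Equiv.swap_apply_right,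
      Matrix.one_apply]
    by_cases hJ : J 0 = J 1
    · rw [if_pos hJ] at h1
      rw [if_pos hJ, if_pos hJ.symm]
      linarith
    · rw [if_neg hJ] at h1
      rw [if_neg hJ, if_neg (Ne.symm hJ)]
      linarith
  · funext a
    have h1 := (hf a).sum_X_mul_pderiv
    rw [one_smul] at h1
    rw [← h1]
    show C s * X a + ∑ i, C (m i a - s * (1 : Matrix (Fin d) (Fin d) ℝ) i a) * X i = _
    simp only [hfm, C_sub, sub_mul, Finset.sum_sub_distrib, Matrix.one_apply, mul_ite,
      mul_one, mul_zero, apply_ite C, map_zero, ite_mul, zero_mul, Finset.sum_ite_eq',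
      Finset.mem_univ, if_true]
    rw [add_sub_cancel]
    exact Finset.sum_congr rfl fun i _ => mul_comm _ _

theorem ConformalKilling.exists_specialField {d : ℕ}
    {f : Fin d → MvPolynomial (Fin d) ℝ} (hf : ∀ a, (f a).IsHomogeneous 2)
    {σ : MvPolynomial (Fin d) ℝ} (hσ : σ.IsHomogeneous 1) (h : ConformalKilling f σ) :
    ∃ v, specialField d v = f := by
  have hs : ∀ i, pderiv i σ = C (coeff 0 (pderiv i σ)) := fun i =>
    eq_C_of_isHomogeneous_zero hσ.pderiv
  set s : Fin d → ℝ := fun i => coeff 0 (pderiv i σ) with hs'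
  -- The special field of `v` has conformal factor `-2 v·x`, so the gradient `s` of `σ` forces `v =
  -- -s/2`. Euler's identity, applied twice, rebuilds `f` from its second derivatives, which are
  -- fixed by `s`.
  refine ⟨fun K => -(1 / 2) * s (K 0), funext fun k => ?_⟩
  have h1 := (hf k).sum_X_mul_pderiv
  have h2 : ∀ j, pderiv j (f k) = ∑ i, X i * pderiv i (pderiv j (f k)) := fun j => by
    rw [((hf k).pderiv (i := j)).sum_X_mul_pderiv, Nat.add_one_sub_one, one_smul]
  have h3 : ∀ j, pderiv j (f k) =
      (if j = k then ∑ i, C (s i) * X i else 0) + C (s j) * X k - C (s k) * X j := by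
    intro j
    rw [h2]
    simp only [h.pderiv_pderiv, mul_sub, mul_add, Finset.sum_sub_distrib, Finset.sum_add_distrib,
      mul_ite, mul_zero, Finset.sum_ite_eq', Finset.mem_univ, if_true]
    rw [hs j, hs k, mul_comm (X k), mul_comm (X j)]
    congr 2
    split_ifs
    · exact Finset.sum_congr rfl fun i _ => by rw [hs i, mul_comm]
    · simp
  have h4 : 2 * f k = 2 * X k * (∑ i, C (s i) * X i) - C (s k) * normSq d := by
    rw [two_smul, ← two_mul] at h1
    rw [← h1]
    simp only [h3, mul_sub, mul_add, Finset.sum_sub_distrib, Finset.sum_add_distrib,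
      mul_ite, mul_zero, Finset.sum_ite_eq', Finset.mem_univ, if_true]
    have h5 : ∑ j, (X j * (C (s j) * X k) : MvPolynomial (Fin d) ℝ) =
        X k * ∑ i, C (s i) * X i := by
      rw [Finset.mul_sum]
      exact Finset.sum_congr rfl fun i _ => by ring
    have h6 : ∑ j, (X j * (C (s k) * X j) : MvPolynomial (Fin d) ℝ) = C (s k) * normSq d := by
      rw [normSq, Finset.mul_sum]
      exact Finset.sum_congr rfl fun i _ => by ring
    rw [h5, h6]
    ring
  have hC : (2 : MvPolynomial (Fin d) ℝ) * C (-(1 / 2)) = -1 := by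
    rw [← map_ofNat C 2, ← C_mul]
    norm_num
  apply mul_left_cancel₀ (two_ne_zero (α := MvPolynomial (Fin d) ℝ))
  rw [h4, specialField_apply]
  simp only [C_mul, mul_assoc, ← Finset.mul_sum]
  linear_combination (C (s k) * normSq d - 2 * (X k * ∑ i, C (s i) * X i)) * hC

/-! ### Solutions of the adjoint equation for the vector charge -/

theorem vectorLaw_adjoint_zero_iff {d : ℕ} {f : Fin d → MvPolynomial (Fin d) ℝ}
    (hf : ∀ a, (f a).IsHomogeneous 0) :
    (∀ E ∈ (vectorLaw d).electric, gaussOp (vectorLaw d) E f = 0) ↔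
      ∃ v, translationField d v = f :=
  iff_of_true (fun E _ => gaussOp_eq_zero_of_lt _ one_pos E hf) (translationField_surjective hf)

theorem vectorLaw_adjoint_one_iff {d : ℕ} (hd : 0 < d) {f : Fin d → MvPolynomial (Fin d) ℝ}
    (hf : ∀ a, (f a).IsHomogeneous 1) :
    (∀ E ∈ (vectorLaw d).electric, gaussOp (vectorLaw d) E f = 0) ↔
      ∃ w, linearField d w = f := by
  rw [vectorLaw_adjoint_iff hd]
  constructor
  · rintro ⟨σ, hσ⟩
    exact hσ.exists_linearField hf (hσ.isHomogeneous_factor hd hf)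
  · rintro ⟨w, rfl⟩
    exact ⟨_, conformalKilling_linearField w⟩

theorem vectorLaw_adjoint_two_iff {d : ℕ} (hd : 0 < d) {f : Fin d → MvPolynomial (Fin d) ℝ}
    (hf : ∀ a, (f a).IsHomogeneous 2) :
    (∀ E ∈ (vectorLaw d).electric, gaussOp (vectorLaw d) E f = 0) ↔
      ∃ v, specialField d v = f := by
  rw [vectorLaw_adjoint_iff hd]
  constructor
  · rintro ⟨σ, hσ⟩
    exact hσ.exists_specialField hf (hσ.isHomogeneous_factor hd hf)
  · rintro ⟨v, rfl⟩
    exact ⟨_, conformalKilling_specialField v⟩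

/-! ### Equivariance of the conformal Killing fields -/

theorem rotate_rank_zero {d : ℕ} (g : Matrix (Fin d) (Fin d) ℝ) (T : Tensor d 0) :
    rotate g T = T := by
  funext J
  show ∑ I : Fin 0 → Fin d, (∏ s, g (J s) (I s)) * T I = T J
  rw [Fintype.sum_unique, Fin.prod_univ_zero, one_mul]
  exact congrArg T (Subsingleton.elim _ _)

theorem rotate_rank_one {d : ℕ} (g : Matrix (Fin d) (Fin d) ℝ) (v : Tensor d 1) (a : Fin d) :
    rotate g v (fun _ => a) = ∑ b, g a b * v fun _ => b := by
  show ∑ I : Fin 1 → Fin d, (∏ s, g a (I s)) * v I = _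
  rw [← (Equiv.funUnique (Fin 1) (Fin d)).symm.sum_comp]
  refine Finset.sum_congr rfl fun b _ => ?_
  rw [Fin.prod_univ_one]
  rfl

theorem rotate_rank_two {d : ℕ} (g : Matrix (Fin d) (Fin d) ℝ) (T : Tensor d 2) (i j : Fin d) :
    rotate g T ![i, j] = ∑ a, ∑ b, g i a * g j b * T ![a, b] := by
  show ∑ I : Fin 2 → Fin d, (∏ s, g (![i, j] s) (I s)) * T I = _
  rw [← (finTwoArrowEquiv (Fin d)).symm.sum_comp, Fintype.sum_prod_type]
  refine Finset.sum_congr rfl fun a _ => Finset.sum_congr rfl fun b _ => ?_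
  simp [Fin.prod_univ_two]

theorem rotate_mem_antisymTensor {d : ℕ} (g : Matrix (Fin d) (Fin d) ℝ) {T : Tensor d 2}
    (hT : T ∈ antisymTensor d) : rotate g T ∈ antisymTensor d := by
  intro J
  have h : J ∘ Equiv.swap 0 1 = ![J 1, J 0] := by
    funext s
    fin_cases s <;> simp
  have h' : rotate g T J = rotate g T ![J 0, J 1] := by rw [pair_eta]
  rw [h, h', rotate_rank_two, rotate_rank_two, Finset.sum_comm, ← Finset.sum_neg_distrib]
  refine Finset.sum_congr rfl fun a _ => ?_
  rw [← Finset.sum_neg_distrib]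
  refine Finset.sum_congr rfl fun b _ => ?_
  rw [show T ![b, a] = -T ![a, b] from antisymTensor_swap ⟨T, hT⟩ b a]
  ring

theorem rotatePoly_C {d : ℕ} (g : Matrix (Fin d) (Fin d) ℝ) (c : ℝ) :
    rotatePoly g (C c) = C c := by
  simp [rotatePoly]

theorem rotatePoly_sum_C_mul_X {d : ℕ} (g : Matrix (Fin d) (Fin d) ℝ) (c : Fin d → ℝ) :
    rotatePoly g (∑ i, C (c i) * X i) = ∑ j, C (∑ i, g j i * c i) * X j := by
  simp only [map_sum, map_mul, rotatePoly_C]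
  simp only [rotatePoly, aeval_X, Finset.mul_sum, Finset.sum_mul]
  rw [Finset.sum_comm]
  exact Finset.sum_congr rfl fun j _ => Finset.sum_congr rfl fun i _ => by ring

theorem translationField_rotate {d : ℕ} (g : SO d) (v : Tensor d 1) (a : Fin d) :
    translationField d (rotate g.1 v) a =
      ∑ b, C (g.1 a b) * rotatePoly g.1 (translationField d v b) := by
  simp only [translationField_apply, rotate_rank_one, rotatePoly_C, map_sum, C_mul]

theorem linearField_rotate {d : ℕ} (g : SO d) (w : Tensor d 0 × antisymTensor d) (a : Fin d) :
    linearField d (rotate g.1 w.1, ⟨rotate g.1 w.2.1, rotate_mem_antisymTensor g.1 w.2.2⟩) a =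
      ∑ b, C (g.1 a b) * rotatePoly g.1 (linearField d w b) := by
  simp only [linearField_apply, rotate_rank_zero, map_add, map_mul, rotatePoly_C,
    rotatePoly_sum_C_mul_X, mul_add, Finset.sum_add_distrib]
  congr 1
  · rw [← sum_C_SO_mul_rotatePoly_X g a, Finset.mul_sum]
    exact Finset.sum_congr rfl fun b _ => by ring
  · simp only [Finset.mul_sum]
    rw [Finset.sum_comm]
    refine Finset.sum_congr rfl fun j _ => ?_
    simp only [← mul_assoc, ← Finset.sum_mul, ← C_mul, ← map_sum]
    congr 2
    rw [rotate_rank_two, Finset.sum_comm]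
    refine Finset.sum_congr rfl fun b _ => ?_
    rw [Finset.mul_sum]
    exact Finset.sum_congr rfl fun i _ => by ring

theorem specialField_rotate {d : ℕ} (g : SO d) (v : Tensor d 1) (a : Fin d) :
    specialField d (rotate g.1 v) a =
      ∑ b, C (g.1 a b) * rotatePoly g.1 (specialField d v b) := by
  simp only [specialField_apply, rotate_rank_one, map_sub, map_mul, rotatePoly_C,
    rotatePoly_sum_C_mul_X, rotatePoly_normSq, mul_sub, Finset.sum_sub_distrib]
  congr 1
  · rw [map_sum, Finset.sum_mul]
    exact Finset.sum_congr rfl fun b _ => by rw [C_mul]; ring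
  · generalize ∑ i, C (∑ b, g.1 i b * v fun _ => b) * X i = S
    rw [map_ofNat, ← sum_C_SO_mul_rotatePoly_X g a, Finset.mul_sum, Finset.sum_mul]
    exact Finset.sum_congr rfl fun b _ => by ring

theorem vectorLaw_exists_cokerZ_equiv_zero (d : ℕ) :
    ∃ e : cokerZ (vectorLaw d) 0 ≃ₗ[ℝ] Tensor d 1,
      ∀ (g : SO d) (M : momentSpace d (Fin d) 0),
        e (Submodule.Quotient.mk (momentRotate (vectorLaw d) 0 g M)) =
          rotate g.1 (e (Submodule.Quotient.mk M)) := by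
  obtain ⟨e, he⟩ := exists_cokerZ_equiv (vectorLaw d) (l := 0) (translationField d)
    (translationField_injective d) isHomogeneous_translationField
    fun f hf => vectorLaw_adjoint_zero_iff hf
  exact ⟨e, fun g => he g (rotate g.1) (translationField_rotate g)⟩

theorem vectorLaw_exists_cokerZ_equiv_one {d : ℕ} (hd : 0 < d) :
    ∃ e : cokerZ (vectorLaw d) 1 ≃ₗ[ℝ] Tensor d 0 × antisymTensor d,
      ∀ (g : SO d) (M : momentSpace d (Fin d) 1),
        (e (Submodule.Quotient.mk (momentRotate (vectorLaw d) 1 g M))).1 =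
          rotate g.1 (e (Submodule.Quotient.mk M)).1 ∧
        (e (Submodule.Quotient.mk (momentRotate (vectorLaw d) 1 g M))).2.1 =
          rotate g.1 (e (Submodule.Quotient.mk M)).2.1 := by
  obtain ⟨e, he⟩ := exists_cokerZ_equiv (vectorLaw d) (l := 1) (linearField d)
    (linearField_injective hd) isHomogeneous_linearField
    fun f hf => vectorLaw_adjoint_one_iff hd hf
  refine ⟨e, fun g M => ?_⟩
  rw [he g (fun w => (rotate g.1 w.1, ⟨rotate g.1 w.2.1, rotate_mem_antisymTensor g.1 w.2.2⟩))
    (linearField_rotate g)]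
  exact ⟨rfl, rfl⟩

theorem vectorLaw_exists_cokerZ_equiv_two {d : ℕ} (hd : 3 ≤ d) :
    ∃ e : cokerZ (vectorLaw d) 2 ≃ₗ[ℝ] Tensor d 1,
      ∀ (g : SO d) (M : momentSpace d (Fin d) 2),
        e (Submodule.Quotient.mk (momentRotate (vectorLaw d) 2 g M)) =
          rotate g.1 (e (Submodule.Quotient.mk M)) := by
  obtain ⟨e, he⟩ := exists_cokerZ_equiv (vectorLaw d) (l := 2) (specialField d)
    (specialField_injective hd) isHomogeneous_specialField
    fun f hf => vectorLaw_adjoint_two_iff (by omega) hf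
  exact ⟨e, fun g => he g (rotate g.1) (specialField_rotate g)⟩

/-! ### Conserved moments of the vector charge -/

theorem vectorLaw_isConserved_zero_iff {d : ℕ} (hd : 0 < d) {f : Fin d → MvPolynomial (Fin d) ℝ}
    (hf : ∀ a, (f a).IsHomogeneous 0) :
    IsConserved (vectorLaw d) f ↔ f ∈ Submodule.span ℝ (Set.range fun i : Fin d =>
      (Pi.single i 1 : Fin d → MvPolynomial (Fin d) ℝ)) := by
  rw [isConserved_iff _ hd]
  refine iff_of_true (fun E _ => gaussOp_eq_zero_of_lt _ one_pos E hf) ?_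
  have h : f = ∑ i, coeff 0 (f i) • (Pi.single i 1 : Fin d → MvPolynomial (Fin d) ℝ) := by
    funext a
    rw [eq_C_of_isHomogeneous_zero (hf a)]
    simp [Finset.sum_apply, Pi.single_apply, smul_eq_C_mul]
  rw [h]
  exact Submodule.sum_mem _ fun i _ => Submodule.smul_mem _ _ (Submodule.subset_span ⟨i, rfl⟩)

theorem range_linearField (d : ℕ) :
    LinearMap.range (linearField d) = Submodule.span ℝ ({fun a => X a} ∪
      Set.range fun ij : Fin d × Fin d =>
        (Pi.single ij.2 (X ij.1) - Pi.single ij.1 (X ij.2) :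
          Fin d → MvPolynomial (Fin d) ℝ)) := by
  apply le_antisymm
  · rintro _ ⟨w, rfl⟩
    -- The sum runs over ordered pairs, so every rotation occurs twice; this accounts for the factor
    -- `1/2`.
    have h : linearField d w = w.1 Fin.elim0 • (fun a => X a) + ∑ i, ∑ j, (w.2.1 ![i, j] / 2) •
        (Pi.single j (X i) - Pi.single i (X j) : Fin d → MvPolynomial (Fin d) ℝ) := by
      funext a
      have h1 : ∀ i, C (w.2.1 ![i, a]) * (X i : MvPolynomial (Fin d) ℝ) =
          (w.2.1 ![i, a] / 2) • X i - (w.2.1 ![a, i] / 2) • X i := by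
        intro i
        rw [antisymTensor_swap w.2 a i, ← sub_smul, smul_eq_C_mul]
        congr 2
        ring
      rw [linearField_apply, Finset.sum_congr rfl fun i _ => h1 i, Finset.sum_sub_distrib]
      simp only [Pi.add_apply, Pi.smul_apply, Finset.sum_apply, Pi.sub_apply, Pi.single_apply,
        smul_sub, smul_ite, smul_zero, Finset.sum_sub_distrib, Finset.sum_ite_eq,
        Finset.mem_univ, if_true, smul_eq_C_mul]
      congr 2
      rw [Finset.sum_comm]
      simp
    rw [h]
    refine add_mem (Submodule.smul_mem _ _ (Submodule.subset_span (Or.inl rfl)))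
      (Submodule.sum_mem _ fun i _ => Submodule.sum_mem _ fun j _ => Submodule.smul_mem _ _
        (Submodule.subset_span (Or.inr ⟨(i, j), rfl⟩)))
  · rw [Submodule.span_le]
    rintro _ (rfl | ⟨⟨i, j⟩, rfl⟩)
    · refine ⟨(fun _ => 1, 0), funext fun a => ?_⟩
      simp [linearField_apply]
    · obtain ⟨δ, hδ⟩ : ∃ δ : Fin d → Fin d → ℝ, ∀ a b, δ a b = if a = b then 1 else 0 :=
        ⟨_, fun _ _ => rfl⟩
      -- The generator is the antisymmetrised elementary matrix `e_i ∧ e_j`.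
      refine ⟨(0, ⟨fun K => δ (K 0) i * δ (K 1) j - δ (K 0) j * δ (K 1) i, fun K => ?_⟩),
        funext fun a => ?_⟩
      · simp only [Function.comp_apply, Equiv.swap_apply_left, Equiv.swap_apply_right]
        ring
      · show C 0 * X a + ∑ m, C (δ m i * δ a j - δ m j * δ a i) * X m = _
        simp [hδ, Pi.single_apply, sub_mul, Finset.sum_sub_distrib, apply_ite C]

theorem vectorLaw_isConserved_one_iff {d : ℕ} (hd : 0 < d) {f : Fin d → MvPolynomial (Fin d) ℝ}
    (hf : ∀ a, (f a).IsHomogeneous 1) :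
    IsConserved (vectorLaw d) f ↔ f ∈ Submodule.span ℝ ({fun a => X a} ∪
      Set.range fun ij : Fin d × Fin d =>
        (Pi.single ij.2 (X ij.1) - Pi.single ij.1 (X ij.2) :
          Fin d → MvPolynomial (Fin d) ℝ)) := by
  rw [isConserved_iff _ hd, vectorLaw_adjoint_one_iff hd hf, ← range_linearField]
  rfl

theorem range_specialField (d : ℕ) :
    LinearMap.range (specialField d) = Submodule.span ℝ (Set.range fun i : Fin d =>
      (Pi.single i (normSq d) - fun a => 2 * X a * X i : Fin d → MvPolynomial (Fin d) ℝ)) := by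
  apply le_antisymm
  · rintro _ ⟨v, rfl⟩
    have h : specialField d v = ∑ i, (v fun _ => i) •
        (Pi.single i (normSq d) - fun a => 2 * X a * X i : Fin d → MvPolynomial (Fin d) ℝ) := by
      funext a
      simp only [specialField_apply, Finset.sum_apply, Pi.smul_apply, Pi.sub_apply,
        Pi.single_apply, smul_sub, Finset.sum_sub_distrib, smul_ite, smul_zero,
        Finset.sum_ite_eq, Finset.mem_univ, if_true, smul_eq_C_mul, Finset.mul_sum]
      congr 1
      exact Finset.sum_congr rfl fun i _ => by ring
    rw [h]
    exact Submodule.sum_mem _ fun i _ => Submodule.smul_mem _ _ (Submodule.subset_span ⟨i, rfl⟩)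
  · rw [Submodule.span_le]
    rintro _ ⟨i, rfl⟩
    refine ⟨fun K => (1 : Matrix (Fin d) (Fin d) ℝ) i (K 0), funext fun a => ?_⟩
    rw [specialField_apply]
    simp [Matrix.one_apply, Pi.single_apply, apply_ite C, eq_comm]

theorem vectorLaw_isConserved_two_iff {d : ℕ} (hd : 0 < d) {f : Fin d → MvPolynomial (Fin d) ℝ}
    (hf : ∀ a, (f a).IsHomogeneous 2) :
    IsConserved (vectorLaw d) f ↔ f ∈ Submodule.span ℝ (Set.range fun i : Fin d =>
      (Pi.single i (normSq d) - fun a => 2 * X a * X i : Fin d → MvPolynomial (Fin d) ℝ)) := by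
  rw [isConserved_iff _ hd, vectorLaw_adjoint_two_iff hd hf, ← range_specialField]
  rfl

/-- The conformal Killing equation has no nonzero homogeneous solution of degree 3 or more; in
degrees 0, 1 and 2 a translation, the dilation and a special conformal field are nonzero witnesses.
-/
theorem vectorLaw_hasConservedMoment_iff {d : ℕ} (hd : 3 ≤ d) (l : ℕ) :
    HasConservedMoment (vectorLaw d) l ↔ l ≤ 2 := by
  have hd0 : 0 < d := by omega
  constructor
  · rintro ⟨f, hf, hf0, hfc⟩
    by_contra! hl
    obtain ⟨σ, hσ⟩ := (vectorLaw_adjoint_iff hd0 f).mp ((isConserved_iff _ hd0 f).mp hfc)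
    exact hf0 (hσ.eq_zero hd hl hf)
  · intro hl
    interval_cases l
    · refine ⟨translationField d fun _ => 1, isHomogeneous_translationField _, fun h => ?_,
        (isConserved_iff _ hd0 _).mpr
          ((vectorLaw_adjoint_zero_iff (isHomogeneous_translationField _)).mpr ⟨_, rfl⟩)⟩
      have := translationField_injective d (h.trans (map_zero _).symm)
      exact one_ne_zero (congrFun this fun _ => ⟨0, hd0⟩)
    · refine ⟨linearField d (fun _ => 1, 0), isHomogeneous_linearField _, fun h => ?_,
        (isConserved_iff _ hd0 _).mpr
          ((vectorLaw_adjoint_one_iff hd0 (isHomogeneous_linearField _)).mpr ⟨_, rfl⟩)⟩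
      have := linearField_injective hd0 (h.trans (map_zero _).symm)
      exact one_ne_zero (congrFun (congrArg Prod.fst this) Fin.elim0)
    · refine ⟨specialField d fun _ => 1, isHomogeneous_specialField _, fun h => ?_,
        (isConserved_iff _ hd0 _).mpr
          ((vectorLaw_adjoint_two_iff hd0 (isHomogeneous_specialField _)).mpr ⟨_, rfl⟩)⟩
      have := specialField_injective hd (h.trans (map_zero _).symm)
      exact one_ne_zero (congrFun this fun _ => ⟨0, hd0⟩)

theorem vectorLaw_subsingleton_cokerZ {d l : ℕ} (hd : 3 ≤ d) (hl : 3 ≤ l) :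
    Subsingleton (cokerZ (vectorLaw d) l) := by
  rw [← not_nontrivial_iff_subsingleton, nontrivial_cokerZ_iff_hasConservedMoment _ (by omega),
    vectorLaw_hasConservedMoment_iff hd]
  omega

theorem vectorLaw_isFractonic {d : ℕ} (hd : 3 ≤ d) : IsFractonic (vectorLaw d) := by
  refine ⟨chargeConserved _ (by omega) one_pos, ?_, 1, le_rfl,
    (vectorLaw_hasConservedMoment_iff hd 1).mpr one_le_two⟩
  exact (Set.finite_Iic 2).subset fun l hl => (vectorLaw_hasConservedMoment_iff hd l).mp hl.2

theorem vectorLaw_not_isHyperFractonic {d : ℕ} (hd : 3 ≤ d) :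
    ¬ IsHyperFractonic (vectorLaw d) :=
  Set.not_infinite.mpr (vectorLaw_isFractonic hd).2.1

end Gauss

end

/-! ### Assembly of the two theories -/

theorem mainTheorem4 :
    -- the Gauss law `∂_{i_1} ⋯ ∂_{i_k} E^{i_1 … i_k} = ρ`
    (∀ d k : ℕ, 2 ≤ d → 1 ≤ k →
      -- the cokernel of `Z` as a representation of `SO(d)`
      (∀ l : ℕ, ∃ e : Gauss.cokerZ (Gauss.scalarLaw d k) l ≃ₗ[ℝ]
          ((n : Finset.Icc (l + 1 - k) (l / 2)) → Gauss.tracelessSym d (l - 2 * n.1)),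
        ∀ (g : Gauss.SO d) (M : Gauss.momentSpace d Unit l)
          (n : Finset.Icc (l + 1 - k) (l / 2)),
          (e (Submodule.Quotient.mk (Gauss.momentRotate (Gauss.scalarLaw d k) l g M)) n).1 =
            Gauss.rotate g.1 (e (Submodule.Quotient.mk M) n).1) ∧
      (∀ l : ℕ, Nontrivial (Gauss.cokerZ (Gauss.scalarLaw d k) l) ↔ l ≤ 2 * k - 2) ∧
      -- a moment is conserved iff its coefficients are orthogonal to the image of `Z`
      (∀ (l : ℕ) (P : Gauss.momentSpace d Unit l),
        Gauss.IsConserved (Gauss.scalarLaw d k) (Gauss.weight P) ↔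
          ∀ M ∈ Gauss.imZ (Gauss.scalarLaw d k) l, Gauss.momentInner P M = 0) ∧
      -- the conserved moments of order `l`
      (∀ (l : ℕ) (f : MvPolynomial (Fin d) ℝ), f.IsHomogeneous l →
        (Gauss.IsConserved (Gauss.scalarLaw d k) (fun _ => f) ↔
          f ∈ Submodule.span ℝ {q | ∃ n : ℕ, l + 1 ≤ n + k ∧ n ≤ l / 2 ∧
            ∃ J : Fin (l - 2 * n) → Fin d,
              q = Gauss.normSq d ^ n * ∏ s, MvPolynomial.X (J s)})) ∧
      (∀ l : ℕ, Gauss.HasConservedMoment (Gauss.scalarLaw d k) l ↔ l ≤ 2 * k - 2) ∧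
      (k = 1 → Gauss.IsNonFractonic (Gauss.scalarLaw d k)) ∧
      (2 ≤ k → Gauss.IsFractonic (Gauss.scalarLaw d k)) ∧
      ¬ Gauss.IsHyperFractonic (Gauss.scalarLaw d k)) ∧
    -- the Gauss law `∂_i E^{ij} = ρ^j`
    (∀ d : ℕ, 3 ≤ d →
      -- the cokernel of `Z` as a representation of `SO(d)`
      (∃ e : Gauss.cokerZ (Gauss.vectorLaw d) 0 ≃ₗ[ℝ] Gauss.Tensor d 1,
        ∀ (g : Gauss.SO d) (M : Gauss.momentSpace d (Fin d) 0),
          e (Submodule.Quotient.mk (Gauss.momentRotate (Gauss.vectorLaw d) 0 g M)) =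
            Gauss.rotate g.1 (e (Submodule.Quotient.mk M))) ∧
      (∃ e : Gauss.cokerZ (Gauss.vectorLaw d) 1 ≃ₗ[ℝ]
          Gauss.Tensor d 0 × Gauss.antisymTensor d,
        ∀ (g : Gauss.SO d) (M : Gauss.momentSpace d (Fin d) 1),
          (e (Submodule.Quotient.mk (Gauss.momentRotate (Gauss.vectorLaw d) 1 g M))).1 =
            Gauss.rotate g.1 (e (Submodule.Quotient.mk M)).1 ∧
          (e (Submodule.Quotient.mk (Gauss.momentRotate (Gauss.vectorLaw d) 1 g M))).2.1 =
            Gauss.rotate g.1 (e (Submodule.Quotient.mk M)).2.1) ∧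
      (∃ e : Gauss.cokerZ (Gauss.vectorLaw d) 2 ≃ₗ[ℝ] Gauss.Tensor d 1,
        ∀ (g : Gauss.SO d) (M : Gauss.momentSpace d (Fin d) 2),
          e (Submodule.Quotient.mk (Gauss.momentRotate (Gauss.vectorLaw d) 2 g M)) =
            Gauss.rotate g.1 (e (Submodule.Quotient.mk M))) ∧
      (∀ l : ℕ, 3 ≤ l → Subsingleton (Gauss.cokerZ (Gauss.vectorLaw d) l)) ∧
      -- a moment is conserved iff its coefficients are orthogonal to the image of `Z`
      (∀ (l : ℕ) (P : Gauss.momentSpace d (Fin d) l),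
        Gauss.IsConserved (Gauss.vectorLaw d) (Gauss.weight P) ↔
          ∀ M ∈ Gauss.imZ (Gauss.vectorLaw d) l, Gauss.momentInner P M = 0) ∧
      -- the conserved moments of order `0`: `∫ ρ^i`
      (∀ f : Fin d → MvPolynomial (Fin d) ℝ, (∀ a, (f a).IsHomogeneous 0) →
        (Gauss.IsConserved (Gauss.vectorLaw d) f ↔
          f ∈ Submodule.span ℝ (Set.range fun i : Fin d =>
            (Pi.single i 1 : Fin d → MvPolynomial (Fin d) ℝ)))) ∧
      -- the conserved moments of order `1`: `∫ x · ρ` and `∫ (x^i ρ^j - x^j ρ^i)`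
      (∀ f : Fin d → MvPolynomial (Fin d) ℝ, (∀ a, (f a).IsHomogeneous 1) →
        (Gauss.IsConserved (Gauss.vectorLaw d) f ↔
          f ∈ Submodule.span ℝ ({fun a => MvPolynomial.X a} ∪
            Set.range fun ij : Fin d × Fin d =>
              (Pi.single ij.2 (MvPolynomial.X ij.1) - Pi.single ij.1 (MvPolynomial.X ij.2) :
                Fin d → MvPolynomial (Fin d) ℝ)))) ∧
      -- the conserved moments of order `2`: `∫ (|x|² ρ^i - 2 (ρ · x) x^i)`
      (∀ f : Fin d → MvPolynomial (Fin d) ℝ, (∀ a, (f a).IsHomogeneous 2) →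
        (Gauss.IsConserved (Gauss.vectorLaw d) f ↔
          f ∈ Submodule.span ℝ (Set.range fun i : Fin d =>
            (Pi.single i (Gauss.normSq d) -
              fun a => 2 * MvPolynomial.X a * MvPolynomial.X i :
                Fin d → MvPolynomial (Fin d) ℝ)))) ∧
      (∀ l : ℕ, Gauss.HasConservedMoment (Gauss.vectorLaw d) l ↔ l ≤ 2) ∧
      Gauss.IsFractonic (Gauss.vectorLaw d) ∧
      ¬ Gauss.IsHyperFractonic (Gauss.vectorLaw d)) := by
  refine ⟨fun d k hd hk => ?_, fun d hd => ?_⟩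
  · have hd0 : 0 < d := by omega
    refine ⟨Gauss.scalarLaw_exists_cokerZ_equiv hd k, fun l => ?_,
      fun l P => Gauss.isConserved_weight_iff _ hd0 P,
      fun l f hf => Gauss.scalarLaw_isConserved_iff_mem_span hd hf,
      Gauss.scalarLaw_hasConservedMoment_iff hd hk, ?_,
      fun hk' => Gauss.scalarLaw_isFractonic hd hk', Gauss.scalarLaw_not_isHyperFractonic hd hk⟩
    · rw [Gauss.nontrivial_cokerZ_iff_hasConservedMoment _ hd0,
        Gauss.scalarLaw_hasConservedMoment_iff hd hk]
    · rintro rfl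
      exact Gauss.scalarLaw_isNonFractonic hd
  · have hd0 : 0 < d := by omega
    exact ⟨Gauss.vectorLaw_exists_cokerZ_equiv_zero d, Gauss.vectorLaw_exists_cokerZ_equiv_one hd0,
      Gauss.vectorLaw_exists_cokerZ_equiv_two hd,
      fun l hl => Gauss.vectorLaw_subsingleton_cokerZ hd hl,
      fun l P => Gauss.isConserved_weight_iff _ hd0 P,
      fun f hf => Gauss.vectorLaw_isConserved_zero_iff hd0 hf,
      fun f hf => Gauss.vectorLaw_isConserved_one_iff hd0 hf,
      fun f hf => Gauss.vectorLaw_isConserved_two_iff hd0 hf,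
      Gauss.vectorLaw_hasConservedMoment_iff hd, Gauss.vectorLaw_isFractonic hd,
      Gauss.vectorLaw_not_isHyperFractonic hd⟩
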